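/- Let $n\ge 1$, let $a\ge 1$ be real, and let $\phi:\mathbb{R}^n\to\mathbb{R}$ be smooth on $\mathbb{R}^n\setminus\{0\}$ and positively homogeneous of degree $a$, i.e. $\phi(r\xi)=r^a\phi(\xi)$ for all $r>0$ and $\xi\in\mathbb{R}^n$. Assume that for every multi-index $\alpha$ there is a constant $C_\alpha$ with $|\partial^\alpha\phi(\xi)|\le C_\alpha|\xi|^{a-|\alpha|}$ for all $\xi\ne 0$, and that $\min_{|\xi|=1}|\nabla\phi(\xi)|>0$. For a Schwartz function $f\in\mathcal{S}(\mathbb{R}^n)$ put $\widehat f(\xi)=\int_{\mathbb{R}^n}e^{-ix\cdot\xi}f(x)\,dx$ and $\|f\|_{H^s(\mathbb{R}^n)}=\|(1+|\xi|^2)^{s/2}\widehat f\,\|_{L^2(\mathbb{R}^n)}$, and for a measurable function $t:\mathbb{R}^n\to[0,1]$ put $$T_{t(x)}f(x)=\int_{\mathbb{R}^n}e^{ix\cdot\xi+it(x)\phi(\xi)}\,\widehat f(\xi)\,d\xi,\qquad x\in\mathbb{R}^n.$$ Let $s_0>0$. Suppose that for every $s>s_0$ there is a constant $C$ such that $$\|T_{t(x)}f\|_{L^2(B(0,1))}\le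 C\,\|f\|_{H^s(\mathbb{R}^n)}$$ for all measurable $t:\mathbb{R}^n\to[0,1]$ and all $f\in\mathcal{S}(\mathbb{R}^n)$. Then for every $s>as_0$ there is a constant $C'$ such that $$\|T_{t(x)}f\|_{L^2(\mathbb{R}^n)}\le C'\,\|f\|_{H^s(\mathbb{R}^n)}$$ for all measurable $t:\mathbb{R}^n\to[0,1]$ and all $f\in\mathcal{S}(\mathbb{R}^n)$. -/

import Mathlib

open MeasureTheory SchwartzMap FourierTransform
open scoped ContDiff ENNReal NNReal RealInnerProductSpace

noncomputable section

namespace LocalGlobal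

/-- The Fourier transform `f̂(ξ) = ∫ e^{-i x·ξ} f(x) dx` of a Schwartz function. Mathlib's `𝓕 f`
has the kernel `e^{-2πi x·ξ}`, so `f̂(ξ) = 𝓕 f (ξ / 2π)`; see `hat_eq_integral`. -/
def hat {n : ℕ} (f : 𝓢(EuclideanSpace ℝ (Fin n), ℂ)) (ξ : EuclideanSpace ℝ (Fin n)) : ℂ :=
  𝓕 f ((2 * Real.pi)⁻¹ • ξ)

theorem hat_eq_integral {n : ℕ} (f : 𝓢(EuclideanSpace ℝ (Fin n), ℂ))
    (ξ : EuclideanSpace ℝ (Fin n)) :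
    hat f ξ = ∫ x, Complex.exp (-(Complex.I * (⟪x, ξ⟫ : ℝ))) * f x := by
  rw [hat, SchwartzMap.fourier_coe, Real.fourier_eq']
  refine integral_congr_ae (Filter.Eventually.of_forall fun x => ?_)
  simp only [smul_eq_mul, inner_smul_right]
  congr 2
  push_cast
  have : (Real.pi : ℂ) ≠ 0 := by exact_mod_cast Real.pi_ne_zero
  field_simp

/-- The Sobolev norm `‖f‖_{H^s} = ‖⟨ξ⟩^s f̂‖_{L²}`, `⟨ξ⟩ = (1 + |ξ|²)^{1/2}`, as an extended
nonnegative real. -/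
def sobolevNorm {n : ℕ} (s : ℝ) (f : 𝓢(EuclideanSpace ℝ (Fin n), ℂ)) : ℝ≥0∞ :=
  eLpNorm (fun ξ => (((1 + ‖ξ‖ ^ 2) ^ (s / 2) : ℝ) : ℂ) * hat f ξ) 2 volume

/-- The linearised operator `T_{t(x)} f(x) = ∫ e^{i x·ξ + i t(x) φ(ξ)} f̂(ξ) dξ`. -/
def linOp {n : ℕ} (φ t : EuclideanSpace ℝ (Fin n) → ℝ) (f : 𝓢(EuclideanSpace ℝ (Fin n), ℂ))
    (x : EuclideanSpace ℝ (Fin n)) : ℂ :=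
  ∫ ξ, Complex.exp (Complex.I * ((⟪x, ξ⟫ + t x * φ ξ : ℝ) : ℂ)) * hat f ξ

/-- The phase functions: real-valued, smooth away from the origin, positively homogeneous of
degree `a`, with `|∂^α φ(ξ)| ≲ |ξ|^{a-|α|}` for every `α` and with `min_{|ξ|=1} |∇φ(ξ)| > 0`. -/
structure IsPhase {n : ℕ} (a : ℝ) (φ : EuclideanSpace ℝ (Fin n) → ℝ) : Prop where
  contDiffOn : ContDiffOn ℝ ∞ φ {0}ᶜ
  homogeneous : ∀ r : ℝ, 0 < r → ∀ ξ, φ (r • ξ) = r ^ a * φ ξ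
  deriv_bound : ∀ k : ℕ, ∃ C : ℝ, ∀ ξ, ξ ≠ 0 → ‖iteratedFDeriv ℝ k φ ξ‖ ≤ C * ‖ξ‖ ^ (a - k)
  gradient_bound : ∃ m : ℝ, 0 < m ∧ ∀ ξ, ‖ξ‖ = 1 → m ≤ ‖gradient φ ξ‖

/-- The bound `‖T_{t(x)} f‖_{L²(Ω)} ≲ ‖f‖_{H^s}` for all Schwartz `f`, with one constant that
serves all measurable `t` with values in `[0, 1]`. -/
def UniformBound {n : ℕ} (φ : EuclideanSpace ℝ (Fin n) → ℝ) (Ω : Set (EuclideanSpace ℝ (Fin n)))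
    (s : ℝ) : Prop :=
  ∃ C : ℝ≥0, ∀ t : EuclideanSpace ℝ (Fin n) → ℝ, Measurable t → (∀ x, 0 ≤ t x ∧ t x ≤ 1) →
    ∀ f : 𝓢(EuclideanSpace ℝ (Fin n), ℂ),
      eLpNorm (linOp φ t f) 2 (volume.restrict Ω) ≤ C * sobolevNorm s f

end LocalGlobal

end

/-! The mechanism is finite speed of propagation. At frequencies of size `l ≥ 1` and times in
`[0,1]` the group velocity is at most of order `l^(a-1)`, so the convolution kernel of the
propagator is negligible at distances beyond `ρ = l^(a-1+ε)` (`IsPhase.exists_kernel_tail`). On a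
ball of radius `ρ` only the data in a concentric ball of radius `3ρ` matter, up to an integrable
tail.

On such a ball the local hypothesis applies after rescaling
(`IsPhase.exists_lintegral_ball_osc_le`). Dilating by `ρ` sends frequency `l` to `ρl = l^(a+ε)` and
time `t` to `ρ^(-a) t`, which stays in `[0,1]` because `ρ ≥ 1`. The `H^s` bound therefore costs
`l^((a+ε)s)`, which is where the factor `a` in the exponent comes from.

Averaging the estimates over all centres makes them global: the near parts add up by Tonelli, the
tails by Young's inequality (`IsPhase.exists_lintegral_osc_annulus_le`). Bounded frequencies need no
hypothesis: the fundamental theorem of calculus in time and Plancherel suffice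
(`IsPhase.exists_lintegral_osc_low_le`). With `(a+ε)s₁ < s` the dyadic pieces sum geometrically
(`exists_eLpNorm_osc_truncHat_le`), and Fatou removes the frequency truncation. -/

noncomputable section

namespace LocalGlobal

/-! ### Test functions on the frequency side, scaling and Plancherel. -/

/-- Smooth compactly supported complex functions. -/
structure IsTest {n : ℕ} (u : EuclideanSpace ℝ (Fin n) → ℂ) : Prop where
  contDiff : ContDiff ℝ ∞ u
  hasCompactSupport : HasCompactSupport u

/-- The oscillatory integral `∫ e^{i x·ξ + i t(x) φ(ξ)} u(ξ) dξ`. -/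
def osc {n : ℕ} (φ t : EuclideanSpace ℝ (Fin n) → ℝ) (u : EuclideanSpace ℝ (Fin n) → ℂ)
    (x : EuclideanSpace ℝ (Fin n)) : ℂ :=
  ∫ ξ, Complex.exp (Complex.I * ((⟪x, ξ⟫ + t x * φ ξ : ℝ) : ℂ)) * u ξ

theorem linOp_eq_osc {n : ℕ} (φ t : EuclideanSpace ℝ (Fin n) → ℝ)
    (f : 𝓢(EuclideanSpace ℝ (Fin n), ℂ)) : linOp φ t f = osc φ t (hat f) := rfl

theorem norm_exp_I_mul_ofReal (r : ℝ) : ‖Complex.exp (Complex.I * (r : ℂ))‖ = 1 := by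
  rw [mul_comm, Complex.norm_exp_ofReal_mul_I]

theorem eLpNorm_two_sq {α F : Type*} [MeasurableSpace α] [NormedAddCommGroup F] (f : α → F)
    (μ : Measure α) : eLpNorm f 2 μ ^ 2 = ∫⁻ x, ‖f x‖ₑ ^ 2 ∂μ := by
  simpa using eLpNorm_nnreal_pow_eq_lintegral (f := f) (μ := μ) (p := 2) (by norm_num)

theorem enorm_add_sq_le {F : Type*} [NormedAddCommGroup F] (x y : F) :
    ‖x + y‖ₑ ^ 2 ≤ 2 * ‖x‖ₑ ^ 2 + 2 * ‖y‖ₑ ^ 2 := by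
  have h : ‖x + y‖ ^ 2 ≤ 2 * ‖x‖ ^ 2 + 2 * ‖y‖ ^ 2 := by
    have := norm_add_le x y
    nlinarith [norm_nonneg (x + y), sq_nonneg (‖x‖ - ‖y‖)]
  have h' : (‖x + y‖₊ ^ 2 : ℝ≥0) ≤ 2 * ‖x‖₊ ^ 2 + 2 * ‖y‖₊ ^ 2 := by exact_mod_cast h
  simp only [enorm_eq_nnnorm]
  exact_mod_cast h'

section Scaling

variable {n : ℕ}

theorem lintegral_comp_smul_eq (F : EuclideanSpace ℝ (Fin n) → ℝ≥0∞) {c : ℝ} (hc : c ≠ 0) :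
    ENNReal.ofReal (|c| ^ n) * ∫⁻ x, F (c • x) = ∫⁻ x, F x := by
  have h1 : ∫⁻ x, F (c • x) = ∫⁻ x, F x ∂(Measure.map (c • ·) volume) :=
    ((Homeomorph.smul (isUnit_iff_ne_zero.2 hc).unit).toMeasurableEquiv.measurableEmbedding.lintegral_map F).symm
  rw [h1, Measure.map_addHaar_smul _ hc, lintegral_smul_measure, finrank_euclideanSpace_fin,
    smul_eq_mul, ← mul_assoc, ← ENNReal.ofReal_mul (by positivity), abs_inv, abs_pow,
    mul_inv_cancel₀ (by positivity), ENNReal.ofReal_one, one_mul]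

theorem volume_ball_mul (x : EuclideanSpace ℝ (Fin n)) {c r : ℝ} (hc : 0 < c) :
    volume (Metric.ball x (c * r)) = ENNReal.ofReal (c ^ n) * volume (Metric.ball x r) := by
  have h := Measure.addHaar_ball_mul_of_pos
    (volume : Measure (EuclideanSpace ℝ (Fin n))) x hc r
  rw [h, Measure.addHaar_ball_center _ x, finrank_euclideanSpace_fin]

theorem lintegral_hat_sq (f : 𝓢(EuclideanSpace ℝ (Fin n), ℂ)) :
    ∫⁻ ξ, ‖hat f ξ‖ₑ ^ 2 = ENNReal.ofReal ((2 * Real.pi) ^ n) * ∫⁻ x, ‖f x‖ₑ ^ 2 := by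
  have hpi := Real.pi_pos
  have h1 : ∫⁻ ξ, ‖𝓕 f ξ‖ₑ ^ 2 = ∫⁻ x, ‖f x‖ₑ ^ 2 := by
    rw [← eLpNorm_two_sq, ← eLpNorm_two_sq]
    have h := norm_fourier_toL2_eq f
    rw [SchwartzMap.norm_toLp, SchwartzMap.norm_toLp] at h
    rw [(ENNReal.toReal_eq_toReal_iff' (SchwartzMap.eLpNorm_lt_top _ _ _).ne
      (SchwartzMap.eLpNorm_lt_top _ _ _).ne).1 h]
  have h2 := lintegral_comp_smul_eq (n := n) (fun ξ => ‖𝓕 f ξ‖ₑ ^ 2) (c := (2 * Real.pi)⁻¹)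
    (by positivity)
  rw [← h1, ← h2, ← mul_assoc, ← ENNReal.ofReal_mul (by positivity), abs_of_pos (by positivity),
    ← mul_pow, mul_inv_cancel₀ (by positivity), one_pow, ENNReal.ofReal_one, one_mul]
  rfl

end Scaling

namespace IsTest

variable {n : ℕ} {u : EuclideanSpace ℝ (Fin n) → ℂ}

theorem integrable (hu : IsTest u) : Integrable u :=
  hu.contDiff.continuous.integrable_of_hasCompactSupport hu.hasCompactSupport

theorem mul_left (hu : IsTest u) {v : EuclideanSpace ℝ (Fin n) → ℂ} (hv : ContDiff ℝ ∞ v) :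
    IsTest fun ξ => v ξ * u ξ :=
  ⟨hv.mul hu.contDiff, hu.hasCompactSupport.mul_left⟩

theorem comp_smul (hu : IsTest u) {c : ℝ} (hc : c ≠ 0) : IsTest fun ξ => u (c • ξ) :=
  ⟨hu.contDiff.comp (contDiff_const_smul c),
    hu.hasCompactSupport.comp_homeomorph (Homeomorph.smul (isUnit_iff_ne_zero.2 hc).unit)⟩

/-- Lets the hypothesis, stated for Schwartz `f`, be applied to any test function prescribed on the
frequency side. -/
theorem exists_hat_eq (hu : IsTest u) :
    ∃ f : 𝓢(EuclideanSpace ℝ (Fin n), ℂ), ∀ ξ, hat f ξ = u ξ := by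
  have hpi := Real.pi_pos
  have h := hu.comp_smul (c := 2 * Real.pi) (by positivity)
  refine ⟨𝓕⁻ (h.hasCompactSupport.toSchwartzMap h.contDiff), fun ξ => ?_⟩
  rw [hat, FourierTransform.fourier_fourierInv_eq]
  change u _ = _
  rw [smul_smul, mul_inv_cancel₀ (by positivity), one_smul]

/-- Plancherel for `hat`, applied to `u` itself; the reflection `x ↦ -x` turns the forward kernel
into the inverse one. -/
theorem lintegral_inverse_sq (hu : IsTest u) :
    ∫⁻ x, ‖∫ ξ, Complex.exp (Complex.I * ((⟪x, ξ⟫ : ℝ) : ℂ)) * u ξ‖ₑ ^ 2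
      = ENNReal.ofReal ((2 * Real.pi) ^ n) * ∫⁻ ξ, ‖u ξ‖ₑ ^ 2 := by
  let U := hu.hasCompactSupport.toSchwartzMap hu.contDiff
  have h := lintegral_hat_sq U
  have h2 := lintegral_comp_smul_eq (n := n) (fun ξ => ‖hat U ξ‖ₑ ^ 2) (c := -1) (by norm_num)
  simp only [abs_neg, abs_one, one_pow, ENNReal.ofReal_one, one_mul] at h2
  rw [← h2] at h
  change _ = _ * ∫⁻ ξ, ‖U ξ‖ₑ ^ 2
  rw [← h]
  refine lintegral_congr fun x => ?_
  rw [hat_eq_integral]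
  congr 3
  ext ξ
  congr 2
  rw [real_inner_comm]
  simp

end IsTest

theorem contDiff_hat {n : ℕ} (f : 𝓢(EuclideanSpace ℝ (Fin n), ℂ)) : ContDiff ℝ ∞ (hat f) :=
  ((𝓕 f).smooth ⊤).comp (contDiff_const_smul _)

theorem integrable_hat {n : ℕ} (f : 𝓢(EuclideanSpace ℝ (Fin n), ℂ)) : Integrable (hat f) :=
  (𝓕 f).integrable.comp_smul (by positivity)

section Osc

variable {n : ℕ} {φ t : EuclideanSpace ℝ (Fin n) → ℝ} {u v : EuclideanSpace ℝ (Fin n) → ℂ}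

theorem integrable_osc (hφ : Measurable φ) (hu : Integrable u) (x : EuclideanSpace ℝ (Fin n)) :
    Integrable fun ξ => Complex.exp (Complex.I * ((⟪x, ξ⟫ + t x * φ ξ : ℝ) : ℂ)) * u ξ := by
  refine hu.bdd_mul (c := 1) ?_ (Filter.Eventually.of_forall fun ξ => ?_)
  · fun_prop
  · rw [norm_exp_I_mul_ofReal]

theorem osc_add (hφ : Measurable φ) (hu : Integrable u) (hv : Integrable v)
    (x : EuclideanSpace ℝ (Fin n)) :
    osc φ t (fun ξ => u ξ + v ξ) x = osc φ t u x + osc φ t v x := by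
  simp only [osc, mul_add]
  exact integral_add (integrable_osc hφ hu x) (integrable_osc hφ hv x)

theorem osc_congr_of_forall {φ' : EuclideanSpace ℝ (Fin n) → ℝ}
    (h : ∀ ξ, u ξ ≠ 0 → φ ξ = φ' ξ) : osc φ t u = osc φ' t u := by
  ext x
  refine integral_congr_ae (Filter.Eventually.of_forall fun ξ => ?_)
  by_cases hξ : u ξ = 0
  · simp [hξ]
  · simp only [h ξ hξ]

theorem stronglyMeasurable_osc (hφ : Measurable φ) (ht : Measurable t) (hu : Continuous u) :
    StronglyMeasurable (osc φ t u) := by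
  refine StronglyMeasurable.integral_prod_right (f := fun x ξ =>
    Complex.exp (Complex.I * ((⟪x, ξ⟫ + t x * φ ξ : ℝ) : ℂ)) * u ξ) ?_
  apply Measurable.stronglyMeasurable
  have : Measurable u := hu.measurable
  simp only [Function.uncurry_def]
  fun_prop

end Osc

end LocalGlobal

end

/-! ### Decay of oscillatory kernels by integration by parts. -/

noncomputable section

namespace LocalGlobal

theorem iteratedDeriv_exp_I_mul (τ : ℝ) (i : ℕ) :
    iteratedDeriv i (fun u : ℝ => Complex.exp (Complex.I * ((τ * u : ℝ) : ℂ)))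
      = fun u => (Complex.I * τ) ^ i * Complex.exp (Complex.I * ((τ * u : ℝ) : ℂ)) := by
  induction i with
  | zero => simp
  | succ i ih =>
    rw [iteratedDeriv_succ, ih]
    ext u
    have h : HasDerivAt (fun u : ℝ => Complex.I * ((τ * u : ℝ) : ℂ)) (Complex.I * τ) u := by
      have h1 : HasDerivAt (fun u : ℝ => ((τ * u : ℝ) : ℂ)) ((τ * 1 : ℝ) : ℂ) u :=
        ((hasDerivAt_id u).const_mul τ).ofReal_comp
      simpa using h1.const_mul Complex.I
    rw [(h.cexp.const_mul _).deriv]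
    ring

theorem norm_iteratedFDeriv_exp_I_mul (τ u : ℝ) (i : ℕ) :
    ‖iteratedFDeriv ℝ i (fun u : ℝ => Complex.exp (Complex.I * ((τ * u : ℝ) : ℂ))) u‖
      = |τ| ^ i := by
  rw [norm_iteratedFDeriv_eq_norm_iteratedDeriv, iteratedDeriv_exp_I_mul, norm_mul,
    norm_exp_I_mul_ofReal, norm_pow, norm_mul, Complex.norm_I, one_mul, mul_one, Complex.norm_real,
    Real.norm_eq_abs]

theorem contDiff_exp_I_mul (τ : ℝ) :
    ContDiff ℝ ∞ fun u : ℝ => Complex.exp (Complex.I * ((τ * u : ℝ) : ℂ)) := by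
  have : ContDiff ℝ ∞ fun u : ℝ => ((τ * u : ℝ) : ℂ) :=
    Complex.ofRealCLM.contDiff.comp (contDiff_const.mul contDiff_id)
  exact (contDiff_const.mul this).cexp

section Kernel

variable {n : ℕ} {ψ : EuclideanSpace ℝ (Fin n) → ℝ} {χ : EuclideanSpace ℝ (Fin n) → ℂ}

theorem contDiff_exp_I_mul_comp (hψ : ContDiff ℝ ∞ ψ) (τ : ℝ) :
    ContDiff ℝ ∞ fun η => Complex.exp (Complex.I * ((τ * ψ η : ℝ) : ℂ)) :=
  (contDiff_exp_I_mul τ).comp hψ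

/-- The geometric form `D ^ i` is the one required by the Faà di Bruno estimate
`norm_iteratedFDeriv_comp_le`. -/
theorem exists_norm_iteratedFDeriv_le_pow (hψ : ContDiff ℝ ∞ ψ) (hψc : HasCompactSupport ψ)
    (M : ℕ) : ∃ D : ℝ, 1 ≤ D ∧ ∀ i, 1 ≤ i → i ≤ M → ∀ η, ‖iteratedFDeriv ℝ i ψ η‖ ≤ D ^ i := by
  have hb : ∀ i : ℕ, ∃ B : ℝ, ∀ η, ‖iteratedFDeriv ℝ i ψ η‖ ≤ B := fun i =>
    (hψ.continuous_iteratedFDeriv (m := i) (mod_cast le_top)).bounded_above_of_compact_support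
      (hψc.iteratedFDeriv i)
  choose B hB using hb
  have h0 : ∀ i ∈ Finset.range (M + 1), (0 : ℝ) ≤ |B i| := fun i _ => abs_nonneg _
  refine ⟨1 + ∑ i ∈ Finset.range (M + 1), |B i|, ?_, fun i hi hiM η => ?_⟩
  · linarith [Finset.sum_nonneg h0]
  · have h1 : |B i| ≤ ∑ i ∈ Finset.range (M + 1), |B i| :=
      Finset.single_le_sum h0 (Finset.mem_range.2 (by omega))
    have h2 : (1 : ℝ) ≤ 1 + ∑ i ∈ Finset.range (M + 1), |B i| := by
      linarith [Finset.sum_nonneg h0]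
    calc ‖iteratedFDeriv ℝ i ψ η‖ ≤ B i := hB i η
      _ ≤ 1 + ∑ i ∈ Finset.range (M + 1), |B i| := by linarith [le_abs_self (B i)]
      _ ≤ _ := le_self_pow₀ h2 (by omega)

/-- Each derivative of `e^{iτψ}` brings down at most one factor `τ`, so the growth in time is
polynomial. -/
theorem exists_norm_iteratedFDeriv_exp_le (hψ : ContDiff ℝ ∞ ψ) (hψc : HasCompactSupport ψ)
    (M : ℕ) : ∃ C : ℝ, 0 ≤ C ∧ ∀ i ≤ M, ∀ τ η,
      ‖iteratedFDeriv ℝ i (fun η => Complex.exp (Complex.I * ((τ * ψ η : ℝ) : ℂ))) η‖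
        ≤ C * (1 + |τ|) ^ M := by
  obtain ⟨D, hD1, hD⟩ := exists_norm_iteratedFDeriv_le_pow hψ hψc M
  refine ⟨M.factorial * D ^ M, by positivity, fun i hi τ η => ?_⟩
  have h := norm_iteratedFDeriv_comp_le (n := i) (C := (1 + |τ|) ^ M) (D := D)
    (contDiff_exp_I_mul τ) hψ (mod_cast le_top) η (fun j hj => ?_)
    (fun j hj hji => hD j hj (hji.trans hi) η)
  · refine h.trans ?_
    have : (i.factorial : ℝ) ≤ M.factorial := mod_cast Nat.factorial_le hi
    have h2 : D ^ i ≤ D ^ M := pow_le_pow_right₀ hD1 hi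
    calc (i.factorial : ℝ) * (1 + |τ|) ^ M * D ^ i
        ≤ M.factorial * (1 + |τ|) ^ M * D ^ M := by gcongr
      _ = _ := by ring
  · rw [norm_iteratedFDeriv_exp_I_mul]
    have : |τ| ≤ 1 + |τ| := by linarith
    calc |τ| ^ j ≤ (1 + |τ|) ^ j := by gcongr
      _ ≤ (1 + |τ|) ^ M := pow_le_pow_right₀ (by linarith [abs_nonneg τ]) (hj.trans hi)

theorem IsTest.integrable_norm_iteratedFDeriv (hχ : IsTest χ) (i : ℕ) :
    Integrable fun η => ‖iteratedFDeriv ℝ i χ η‖ :=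
  ((hχ.contDiff.continuous_iteratedFDeriv (m := i)
    (mod_cast le_top)).integrable_of_hasCompactSupport (hχ.hasCompactSupport.iteratedFDeriv i)).norm

theorem exists_integral_norm_iteratedFDeriv_le (hψ : ContDiff ℝ ∞ ψ) (hψc : HasCompactSupport ψ)
    (hχ : IsTest χ) (M : ℕ) : ∃ C : ℝ, 0 ≤ C ∧ ∀ p ≤ M, ∀ τ,
      ∫ η, ‖iteratedFDeriv ℝ p
        (fun η => Complex.exp (Complex.I * ((τ * ψ η : ℝ) : ℂ)) * χ η) η‖
        ≤ C * (1 + |τ|) ^ M := by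
  obtain ⟨C, hC0, hC⟩ := exists_norm_iteratedFDeriv_exp_le hψ hψc M
  have hpos : ∀ p i : ℕ, 0 ≤ (p.choose i : ℝ) * C * ∫ η, ‖iteratedFDeriv ℝ (p - i) χ η‖ :=
    fun p i => mul_nonneg (by positivity) (integral_nonneg fun _ => norm_nonneg _)
  refine ⟨∑ p ∈ Finset.range (M + 1), ∑ i ∈ Finset.range (p + 1),
    (p.choose i : ℝ) * C * ∫ η, ‖iteratedFDeriv ℝ (p - i) χ η‖,
    Finset.sum_nonneg fun p _ => Finset.sum_nonneg fun i _ => hpos p i, fun p hp τ => ?_⟩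
  have hint : ∀ i ∈ Finset.range (p + 1), Integrable fun η =>
      (p.choose i : ℝ) * (C * (1 + |τ|) ^ M) * ‖iteratedFDeriv ℝ (p - i) χ η‖ := fun i _ =>
    (hχ.integrable_norm_iteratedFDeriv (p - i)).const_mul _
  calc ∫ η, ‖iteratedFDeriv ℝ p
        (fun η => Complex.exp (Complex.I * ((τ * ψ η : ℝ) : ℂ)) * χ η) η‖
      ≤ ∫ η, ∑ i ∈ Finset.range (p + 1),
          (p.choose i : ℝ) * (C * (1 + |τ|) ^ M) * ‖iteratedFDeriv ℝ (p - i) χ η‖ := by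
        refine integral_mono_of_nonneg (Filter.Eventually.of_forall fun _ => norm_nonneg _)
          (integrable_finsetSum _ hint) (Filter.Eventually.of_forall fun η => ?_)
        refine (norm_iteratedFDeriv_mul_le (contDiff_exp_I_mul_comp hψ τ) hχ.contDiff η
          (n := p) (mod_cast le_top)).trans (Finset.sum_le_sum fun i hi => ?_)
        have := hC i (by have := Finset.mem_range.1 hi; omega) τ η
        gcongr
    _ = (∑ i ∈ Finset.range (p + 1),
          (p.choose i : ℝ) * C * ∫ η, ‖iteratedFDeriv ℝ (p - i) χ η‖) * (1 + |τ|) ^ M := by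
        rw [integral_finsetSum _ hint, Finset.sum_mul]
        refine Finset.sum_congr rfl fun i _ => ?_
        rw [integral_const_mul]
        ring
    _ ≤ _ := by
        gcongr
        exact Finset.single_le_sum (f := fun p => ∑ i ∈ Finset.range (p + 1),
          (p.choose i : ℝ) * C * ∫ η, ‖iteratedFDeriv ℝ (p - i) χ η‖)
          (fun p _ => Finset.sum_nonneg fun i _ => hpos p i) (Finset.mem_range.2 (by omega))

/-- Integration by parts `M` times, in the form of the decay of a Fourier transform; evaluating `𝓕
m` at `-w / 2π` produces the kernel `e^{iw·η}`. -/
theorem norm_pow_mul_integral_le {m : EuclideanSpace ℝ (Fin n) → ℂ} (hm : IsTest m) (M : ℕ)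
    (w : EuclideanSpace ℝ (Fin n)) :
    ‖w‖ ^ M * ‖∫ η, Complex.exp (Complex.I * ((⟪w, η⟫ : ℝ) : ℂ)) * m η‖
      ≤ (2 * Real.pi) ^ M * (2 ^ M *
        ∑ p ∈ Finset.range (M + 1), ∫ η, ‖iteratedFDeriv ℝ p m η‖) := by
  have hpi := Real.pi_pos
  have h := Real.pow_mul_norm_iteratedFDeriv_fourier_le (f := m) (K := 0) (N := ⊤) (k := 0) (n := M)
    hm.contDiff (fun k j hk _ => ?_) le_rfl le_top (-(2 * Real.pi)⁻¹ • w)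
  · rw [norm_iteratedFDeriv_zero, norm_smul, mul_pow, norm_neg, norm_inv,
      Real.norm_of_nonneg (by positivity), inv_pow, mul_assoc,
      inv_mul_le_iff₀ (by positivity), Real.fourier_eq'] at h
    simp only [pow_zero, one_mul, Nat.cast_zero, mul_zero, zero_add, Finset.range_one,
      Finset.sum_product, Finset.sum_singleton] at h
    refine le_trans (le_of_eq ?_) h
    congr 2
    refine integral_congr_ae (Filter.Eventually.of_forall fun η => ?_)
    simp only [smul_eq_mul, neg_smul, inner_neg_right, inner_smul_right]
    congr 2
    rw [real_inner_comm]
    push_cast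
    have : (Real.pi : ℂ) ≠ 0 := by exact_mod_cast hpi.ne'
    field_simp
  · obtain rfl : k = 0 := by simpa using hk
    simpa using hm.integrable_norm_iteratedFDeriv j

/-- Decay of the kernel of a frequency-localised propagator, with polynomial loss in the time. -/
theorem exists_kernel_bound (hψ : ContDiff ℝ ∞ ψ) (hψc : HasCompactSupport ψ) (hχ : IsTest χ)
    (M : ℕ) : ∃ C : ℝ, 0 ≤ C ∧ ∀ τ w,
      ‖w‖ ^ M * ‖∫ η, Complex.exp (Complex.I * ((⟪w, η⟫ : ℝ) : ℂ)) *
        (Complex.exp (Complex.I * ((τ * ψ η : ℝ) : ℂ)) * χ η)‖ ≤ C * (1 + |τ|) ^ M := by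
  have hpi := Real.pi_pos
  obtain ⟨C, hC0, hC⟩ := exists_integral_norm_iteratedFDeriv_le hψ hψc hχ M
  refine ⟨(2 * Real.pi) ^ M * (2 ^ M * ((M + 1) * C)), by positivity, fun τ w => ?_⟩
  refine (norm_pow_mul_integral_le (hχ.mul_left (contDiff_exp_I_mul_comp hψ τ)) M w).trans ?_
  have h : ∑ p ∈ Finset.range (M + 1), ∫ η, ‖iteratedFDeriv ℝ p
      (fun η => Complex.exp (Complex.I * ((τ * ψ η : ℝ) : ℂ)) * χ η) η‖
      ≤ (M + 1) * (C * (1 + |τ|) ^ M) := by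
    refine (Finset.sum_le_card_nsmul _ _ (C * (1 + |τ|) ^ M) fun p hp =>
      hC p (by have := Finset.mem_range.1 hp; omega) τ).trans (le_of_eq ?_)
    simp
  calc _ ≤ (2 * Real.pi) ^ M * (2 ^ M * ((M + 1) * (C * (1 + |τ|) ^ M))) := by gcongr
    _ = _ := by ring

end Kernel

end LocalGlobal

end

noncomputable section

namespace LocalGlobal

/-! ### Averaging over balls, Young's inequality and multipliers as convolutions. -/

section Integrals

variable {n : ℕ}

/-- Tonelli: a point `x` is counted by exactly the centres in the ball of radius `r` about `x`. This
replaces a covering argument in the passage from local to global. -/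
theorem lintegral_lintegral_ball {F : EuclideanSpace ℝ (Fin n) → ℝ≥0∞} (hF : Measurable F)
    (r : ℝ) :
    ∫⁻ x₀, ∫⁻ x in Metric.ball x₀ r, F x
      = volume (Metric.ball (0 : EuclideanSpace ℝ (Fin n)) r) * ∫⁻ x, F x := by
  have hS : MeasurableSet {p : EuclideanSpace ℝ (Fin n) × EuclideanSpace ℝ (Fin n) |
      dist p.2 p.1 < r} :=
    measurableSet_lt (measurable_snd.dist measurable_fst) measurable_const
  calc ∫⁻ x₀, ∫⁻ x in Metric.ball x₀ r, F x
      = ∫⁻ x₀, ∫⁻ x, {p : EuclideanSpace ℝ (Fin n) × EuclideanSpace ℝ (Fin n) |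
          dist p.2 p.1 < r}.indicator (fun p => F p.2) (x₀, x) := by
        refine lintegral_congr fun x₀ => ?_
        rw [← lintegral_indicator measurableSet_ball]
        rfl
    _ = ∫⁻ x, ∫⁻ x₀, {p : EuclideanSpace ℝ (Fin n) × EuclideanSpace ℝ (Fin n) |
          dist p.2 p.1 < r}.indicator (fun p => F p.2) (x₀, x) :=
        lintegral_lintegral_swap ((hF.comp measurable_snd).indicator hS).aemeasurable
    _ = ∫⁻ x, volume (Metric.ball (0 : EuclideanSpace ℝ (Fin n)) r) * F x := by
        refine lintegral_congr fun x => ?_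
        have : ∀ x₀, {p : EuclideanSpace ℝ (Fin n) × EuclideanSpace ℝ (Fin n) |
            dist p.2 p.1 < r}.indicator (fun p => F p.2) (x₀, x)
            = (Metric.ball x r).indicator (fun _ => F x) x₀ := by
          intro x₀
          simp only [Set.indicator, Set.mem_ofPred_eq, Metric.mem_ball, dist_comm]
        simp only [this]
        rw [lintegral_indicator_const measurableSet_ball, mul_comm, Measure.addHaar_ball_center]
    _ = _ := lintegral_const_mul _ hF

/-- Cauchy–Schwarz for the splitting `W G = W^{1/2} · (W^{1/2} G)`. -/
theorem sq_lintegral_mul_le {α : Type*} [MeasurableSpace α] {μ : Measure α} {W G : α → ℝ≥0∞}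
    (hW : AEMeasurable W μ) (hG : AEMeasurable G μ) :
    (∫⁻ x, W x * G x ∂μ) ^ 2 ≤ (∫⁻ x, W x ∂μ) * ∫⁻ x, W x * G x ^ 2 ∂μ := by
  have hhalf : ∀ w : ℝ≥0∞, w ^ (1 / 2 : ℝ) * w ^ (1 / 2 : ℝ) = w := fun w => by
    rw [← ENNReal.rpow_add_of_nonneg _ _ (by norm_num) (by norm_num)]
    norm_num
  have h := ENNReal.lintegral_mul_le_Lp_mul_Lq μ Real.HolderConjugate.two_two
    (f := fun x => W x ^ (1 / 2 : ℝ)) (g := fun x => W x ^ (1 / 2 : ℝ) * G x)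
    (hW.pow_const _) ((hW.pow_const _).mul hG)
  simp only [Pi.mul_apply, ← mul_assoc, hhalf, ENNReal.rpow_two, mul_pow, sq (_ ^ (1 / 2 : ℝ))] at h
  calc _ ≤ _ := pow_le_pow_left' h 2
    _ = _ := by rw [mul_pow, sq (_ ^ (1 / 2 : ℝ)), sq (_ ^ (1 / 2 : ℝ)), hhalf, hhalf]

/-- Young's convolution inequality `L¹ * L² ⊆ L²`. -/
theorem lintegral_sq_convolution_le {W G : EuclideanSpace ℝ (Fin n) → ℝ≥0∞} (hW : Measurable W)
    (hG : Measurable G) :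
    ∫⁻ x, (∫⁻ y, W (x - y) * G y) ^ 2 ≤ (∫⁻ x, W x) ^ 2 * ∫⁻ y, G y ^ 2 := by
  have hWx : ∀ x, ∫⁻ y, W (x - y) = ∫⁻ y, W y := fun x => lintegral_sub_left_eq_self W x
  have hWy : ∀ y, ∫⁻ x, W (x - y) = ∫⁻ y, W y := fun y => lintegral_sub_right_eq_self W y
  calc ∫⁻ x, (∫⁻ y, W (x - y) * G y) ^ 2
      ≤ ∫⁻ x, (∫⁻ y, W y) * ∫⁻ y, W (x - y) * G y ^ 2 := by
        refine lintegral_mono fun x => ?_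
        have h := sq_lintegral_mul_le (μ := volume) (W := fun y => W (x - y)) (G := G)
          (by fun_prop) hG.aemeasurable
        rwa [hWx] at h
    _ = (∫⁻ y, W y) * ∫⁻ x, ∫⁻ y, W (x - y) * G y ^ 2 :=
        lintegral_const_mul _ (Measurable.lintegral_prod_right (by fun_prop))
    _ = (∫⁻ y, W y) * ∫⁻ y, ∫⁻ x, W (x - y) * G y ^ 2 := by
        rw [lintegral_lintegral_swap (by fun_prop)]
    _ = (∫⁻ y, W y) * ∫⁻ y, (∫⁻ y, W y) * G y ^ 2 := by
        congr 1
        refine lintegral_congr fun y => ?_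
        rw [lintegral_mul_const _ (by fun_prop), hWy]
    _ = _ := by
        rw [lintegral_const_mul _ (by fun_prop), sq, mul_assoc]

/-- Fubini turns a Fourier multiplier into convolution with its kernel, which is where spatial
localisation of `G` becomes usable. -/
theorem integral_mul_hat {m : EuclideanSpace ℝ (Fin n) → ℂ} (hm : Integrable m)
    (G : 𝓢(EuclideanSpace ℝ (Fin n), ℂ)) (x : EuclideanSpace ℝ (Fin n)) :
    ∫ ξ, Complex.exp (Complex.I * ((⟪x, ξ⟫ : ℝ) : ℂ)) * (m ξ * hat G ξ)
      = ∫ y, (∫ ξ, Complex.exp (Complex.I * ((⟪x - y, ξ⟫ : ℝ) : ℂ)) * m ξ) * G y := by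
  have hint : Integrable (Function.uncurry fun ξ y =>
      Complex.exp (Complex.I * ((⟪x - y, ξ⟫ : ℝ) : ℂ)) * (m ξ * G y))
      ((volume : Measure (EuclideanSpace ℝ (Fin n))).prod volume) := by
    refine (hm.mul_prod (G.integrable (μ := volume))).bdd_mul (c := 1) ?_
      (Filter.Eventually.of_forall fun p => ?_)
    · fun_prop
    · rw [norm_exp_I_mul_ofReal]
  calc _ = ∫ ξ, ∫ y, Complex.exp (Complex.I * ((⟪x - y, ξ⟫ : ℝ) : ℂ)) * (m ξ * G y) := by
        refine integral_congr_ae (Filter.Eventually.of_forall fun ξ => ?_)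
        simp only [hat_eq_integral]
        rw [← integral_const_mul, ← integral_const_mul]
        refine integral_congr_ae (Filter.Eventually.of_forall fun y => ?_)
        simp only [inner_sub_left]
        push_cast
        rw [mul_sub, sub_eq_add_neg, Complex.exp_add]
        ring
    _ = ∫ y, ∫ ξ, Complex.exp (Complex.I * ((⟪x - y, ξ⟫ : ℝ) : ℂ)) * (m ξ * G y) :=
        integral_integral_swap hint
    _ = _ := by
        refine integral_congr_ae (Filter.Eventually.of_forall fun y => ?_)
        simp only [← mul_assoc]
        rw [integral_mul_const]

end Integrals

/-! ### Smooth replacements of the phase, cutoffs, and the tail of the propagator kernel. -/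

section Phase

variable {n : ℕ} {a : ℝ} {φ : EuclideanSpace ℝ (Fin n) → ℝ}

theorem IsPhase.measurable (hφ : IsPhase a φ) : Measurable φ :=
  measurable_of_continuousOn_compl_singleton 0 hφ.contDiffOn.continuousOn

/-- The phase may be singular at the origin, while the kernel and time-derivative estimates want a
globally smooth one. Away from `0` the two cannot be told apart by a frequency-localised integral.
-/
theorem IsPhase.exists_smooth_eq_on_annulus (hφ : IsPhase a φ) {r R : ℝ} (hr : 0 < r)
    (hR : 0 < R) :
    ∃ ψ : EuclideanSpace ℝ (Fin n) → ℝ, ContDiff ℝ ∞ ψ ∧ HasCompactSupport ψ ∧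
      ∀ ξ, r ≤ ‖ξ‖ → ‖ξ‖ ≤ R → ψ ξ = φ ξ := by
  let b : ContDiffBump (0 : EuclideanSpace ℝ (Fin n)) := ⟨r / 2, r, by positivity, by linarith⟩
  let B : ContDiffBump (0 : EuclideanSpace ℝ (Fin n)) := ⟨R, R + 1, hR, by linarith⟩
  refine ⟨fun ξ => B ξ * ((1 - b ξ) * φ ξ), ?_, B.hasCompactSupport.mul_right, fun ξ h1 h2 => ?_⟩
  · rw [contDiff_iff_contDiffAt]
    intro ξ
    refine B.contDiffAt.mul ?_
    rcases eq_or_ne ξ 0 with rfl | hξ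
    · refine (contDiffAt_const (c := (0 : ℝ))).congr_of_eventuallyEq ?_
      filter_upwards [b.eventuallyEq_one] with η hη
      simp [hη]
    · exact (contDiffAt_const.sub b.contDiffAt).mul
        (hφ.contDiffOn.contDiffAt (isOpen_compl_singleton.mem_nhds hξ))
  · have hB : B ξ = 1 := B.one_of_mem_closedBall (by simpa [B] using h2)
    have hb : b ξ = 0 := b.zero_of_le_dist (by simpa [b] using h1)
    simp [hB, hb]

end Phase

section Cutoff

variable {n : ℕ}

/-- A smooth cutoff that is `1` on the unit ball and vanishes off the ball of radius `2`. -/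
def cutoff (n : ℕ) : ContDiffBump (0 : EuclideanSpace ℝ (Fin n)) :=
  ⟨1, 2, by norm_num, by norm_num⟩

theorem cutoff_eq_one {ξ : EuclideanSpace ℝ (Fin n)} (h : ‖ξ‖ ≤ 1) : cutoff n ξ = 1 :=
  (cutoff n).one_of_mem_closedBall (by simpa [cutoff] using h)

theorem cutoff_eq_zero {ξ : EuclideanSpace ℝ (Fin n)} (h : 2 ≤ ‖ξ‖) : cutoff n ξ = 0 :=
  (cutoff n).zero_of_le_dist (by simpa [cutoff] using h)

theorem isTest_cutoff_smul {c : ℝ} (hc : c ≠ 0) :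
    IsTest fun ξ : EuclideanSpace ℝ (Fin n) => ((cutoff n (c • ξ) : ℝ) : ℂ) := by
  have h : IsTest fun ξ : EuclideanSpace ℝ (Fin n) => ((cutoff n ξ : ℝ) : ℂ) :=
    ⟨Complex.ofRealCLM.contDiff.comp (cutoff n).contDiff,
      (cutoff n).hasCompactSupport.comp_left Complex.ofReal_zero⟩
  exact h.comp_smul hc

theorem IsTest.sub {u v : EuclideanSpace ℝ (Fin n) → ℂ} (hu : IsTest u) (hv : IsTest v) :
    IsTest fun ξ => u ξ - v ξ :=
  ⟨hu.contDiff.sub hv.contDiff, hu.hasCompactSupport.sub hv.hasCompactSupport⟩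

/-- A smooth cutoff that is `1` for `1/2 ≤ |ξ| ≤ 2` and vanishes unless `1/4 ≤ |ξ| ≤ 4`. -/
def annulus (n : ℕ) (ξ : EuclideanSpace ℝ (Fin n)) : ℂ :=
  ((cutoff n ((1 / 2 : ℝ) • ξ) : ℝ) : ℂ) - ((cutoff n ((4 : ℝ) • ξ) : ℝ) : ℂ)

theorem isTest_annulus : IsTest (annulus n) :=
  (isTest_cutoff_smul (by norm_num)).sub (isTest_cutoff_smul (by norm_num))

theorem annulus_eq_one {ξ : EuclideanSpace ℝ (Fin n)} (h : 1 / 2 ≤ ‖ξ‖) (h' : ‖ξ‖ ≤ 2) :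
    annulus n ξ = 1 := by
  rw [annulus, cutoff_eq_one, cutoff_eq_zero]
  · simp
  · rw [norm_smul, Real.norm_of_nonneg (by norm_num)]; linarith
  · rw [norm_smul, Real.norm_of_nonneg (by norm_num)]; linarith

theorem of_annulus_ne_zero {ξ : EuclideanSpace ℝ (Fin n)} (h : annulus n ξ ≠ 0) :
    1 / 4 ≤ ‖ξ‖ ∧ ‖ξ‖ ≤ 4 := by
  by_contra hcon
  refine h ?_
  rw [not_and_or, not_le, not_le] at hcon
  rcases hcon with hlt | hlt
  · rw [annulus, cutoff_eq_one, cutoff_eq_one]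
    · simp
    · rw [norm_smul, Real.norm_of_nonneg (by norm_num)]; linarith
    · rw [norm_smul, Real.norm_of_nonneg (by norm_num)]; linarith
  · rw [annulus, cutoff_eq_zero, cutoff_eq_zero]
    · simp
    · rw [norm_smul, Real.norm_of_nonneg (by norm_num)]; linarith
    · rw [norm_smul, Real.norm_of_nonneg (by norm_num)]; linarith

theorem norm_ofReal_cutoff_sub_le (ξ η : EuclideanSpace ℝ (Fin n)) :
    ‖((cutoff n ξ : ℝ) : ℂ) - ((cutoff n η : ℝ) : ℂ)‖ ≤ 1 := by
  rw [← Complex.ofReal_sub, Complex.norm_real, Real.norm_eq_abs, abs_le]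
  have h1 := (cutoff n).nonneg (x := ξ)
  have h2 := (cutoff n).le_one (x := ξ)
  have h3 := (cutoff n).nonneg (x := η)
  have h4 := (cutoff n).le_one (x := η)
  constructor <;> linarith

end Cutoff

section KernelTail

variable {n : ℕ} {a : ℝ} {φ : EuclideanSpace ℝ (Fin n) → ℝ}

/-- The substitution `ξ = lη` reduces frequency `l` to frequency `1`; by homogeneity the time
becomes `τ l^a`. -/
theorem IsPhase.kernel_rescale (hφ : IsPhase a φ) {χ : EuclideanSpace ℝ (Fin n) → ℂ} {l : ℝ}
    (hl : 0 < l) (τ : ℝ) (z : EuclideanSpace ℝ (Fin n)) :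
    ∫ ξ, Complex.exp (Complex.I * ((⟪z, ξ⟫ : ℝ) : ℂ)) *
        (Complex.exp (Complex.I * ((τ * φ ξ : ℝ) : ℂ)) * χ (l⁻¹ • ξ))
      = (l ^ n : ℝ) * ∫ η, Complex.exp (Complex.I * ((⟪l • z, η⟫ : ℝ) : ℂ)) *
        (Complex.exp (Complex.I * ((τ * l ^ a * φ η : ℝ) : ℂ)) * χ η) := by
  have h := Measure.integral_comp_smul (volume : Measure (EuclideanSpace ℝ (Fin n)))
    (fun ξ => Complex.exp (Complex.I * ((⟪z, ξ⟫ : ℝ) : ℂ)) *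
        (Complex.exp (Complex.I * ((τ * φ ξ : ℝ) : ℂ)) * χ (l⁻¹ • ξ))) l
  rw [finrank_euclideanSpace_fin, abs_of_pos (by positivity), Complex.real_smul] at h
  have h2 : ((l ^ n : ℝ) : ℂ) * (((l ^ n)⁻¹ : ℝ) : ℂ) = 1 := by
    rw [← Complex.ofReal_mul, mul_inv_cancel₀ (by positivity), Complex.ofReal_one]
  rw [← one_mul (∫ ξ, _), ← h2, mul_assoc, ← h]
  congr 1
  refine integral_congr_ae (Filter.Eventually.of_forall fun η => ?_)
  simp only [hφ.homogeneous l hl, smul_smul, inv_mul_cancel₀ hl.ne', one_smul, inner_smul_right,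
    inner_smul_left, mul_assoc]
  rfl

theorem IsPhase.exists_kernel_bound (hφ : IsPhase a φ) (M : ℕ) :
    ∃ C : ℝ, 0 ≤ C ∧ ∀ τ w,
      ‖w‖ ^ M * ‖∫ η, Complex.exp (Complex.I * ((⟪w, η⟫ : ℝ) : ℂ)) *
        (Complex.exp (Complex.I * ((τ * φ η : ℝ) : ℂ)) * annulus n η)‖ ≤ C * (1 + |τ|) ^ M := by
  obtain ⟨ψ, hψ, hψc, hψφ⟩ := hφ.exists_smooth_eq_on_annulus (r := 1 / 4) (R := 4) (by norm_num)
    (by norm_num)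
  obtain ⟨C, hC0, hC⟩ := LocalGlobal.exists_kernel_bound hψ hψc (isTest_annulus (n := n)) M
  refine ⟨C, hC0, fun τ w => le_of_eq_of_le ?_ (hC τ w)⟩
  congr 2
  refine integral_congr_ae (Filter.Eventually.of_forall fun η => ?_)
  by_cases h : annulus n η = 0
  · simp [h]
  · obtain ⟨h1, h2⟩ := of_annulus_ne_zero h
    simp only [hψφ η h1 h2]

/-- At unit frequency the kernel is `O((time / distance)^M)`, here with time at most of order `l^a`
and distance `l‖z‖`. Each power thus contributes `l^(a-1) / ‖z‖ ≤ l^(-ε)`. Of the `M = n+1+L`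
powers, `n+1` give the integrable decay and `L` pay for all remaining powers of `l`. -/
theorem IsPhase.exists_kernel_tail (hφ : IsPhase a φ) (ha : 1 ≤ a) {ε : ℝ} (hε : 0 < ε) :
    ∃ C : ℝ, 0 ≤ C ∧ ∀ l τ : ℝ, 1 ≤ l → 0 ≤ τ → τ ≤ 1 → ∀ z : EuclideanSpace ℝ (Fin n),
      l ^ (a - 1 + ε) ≤ ‖z‖ →
      ‖∫ ξ, Complex.exp (Complex.I * ((⟪z, ξ⟫ : ℝ) : ℂ)) *
        (Complex.exp (Complex.I * ((τ * φ ξ : ℝ) : ℂ)) * annulus n (l⁻¹ • ξ))‖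
        ≤ C * (1 + ‖z‖) ^ (-((n : ℝ) + 1)) := by
  -- `εL ≥ n + (a-1)(n+1)` is exactly the comparison of exponents of `l` needed in `h4`.
  obtain ⟨L, hL⟩ := exists_nat_ge ((n + (a - 1) * (n + 1)) / ε)
  rw [div_le_iff₀ hε] at hL
  obtain ⟨C, hC0, hC⟩ := hφ.exists_kernel_bound (n + 1 + L)
  refine ⟨C * 2 ^ (n + 1 + L) * 2 ^ (n + 1), by positivity, fun l τ hl hτ0 hτ1 z hz => ?_⟩
  have hl0 : 0 < l := by linarith
  have hρ1 : 1 ≤ l ^ (a - 1 + ε) := Real.one_le_rpow hl (by linarith)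
  have hz1 : 1 ≤ ‖z‖ := hρ1.trans hz
  have hla : 1 ≤ l ^ a := Real.one_le_rpow hl (by linarith)
  have h := hC (τ * l ^ a) (l • z)
  rw [hφ.kernel_rescale hl0, norm_mul, Complex.norm_real, Real.norm_of_nonneg (by positivity)]
  set K := ‖∫ η, Complex.exp (Complex.I * ((⟪l • z, η⟫ : ℝ) : ℂ)) *
        (Complex.exp (Complex.I * ((τ * l ^ a * φ η : ℝ) : ℂ)) * annulus n η)‖ with hK
  have hK0 : 0 ≤ K := norm_nonneg _
  rw [norm_smul, Real.norm_of_nonneg hl0.le, abs_of_nonneg (by positivity)] at h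
  have h1 : (1 + τ * l ^ a) ^ (n + 1 + L) ≤ (2 * l ^ a) ^ (n + 1 + L) := by
    gcongr
    nlinarith
  have h2 : (1 + ‖z‖) ^ (n + 1) ≤ 2 ^ (n + 1) * ‖z‖ ^ (n + 1) := by
    rw [← mul_pow]
    gcongr
    linarith
  have h3 : (l ^ (a - 1 + ε)) ^ L ≤ ‖z‖ ^ L := by gcongr
  have h4 : l ^ n * (l ^ a) ^ (n + 1 + L) ≤ l ^ (n + 1 + L) * (l ^ (a - 1 + ε)) ^ L := by
    rw [← Real.rpow_natCast l n, ← Real.rpow_natCast l (n + 1 + L), ← Real.rpow_mul_natCast hl0.le,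
      ← Real.rpow_mul_natCast hl0.le, ← Real.rpow_add hl0, ← Real.rpow_add hl0]
    refine Real.rpow_le_rpow_of_exponent_le hl ?_
    push_cast
    nlinarith
  rw [Real.rpow_neg (by positivity), ← div_eq_mul_inv, le_div_iff₀ (by positivity)]
  have h5 : (1 + ‖z‖) ^ ((n : ℝ) + 1) = (1 + ‖z‖) ^ (n + 1) := by exact_mod_cast Real.rpow_natCast _ _
  rw [h5]
  have hP : 0 < l ^ (n + 1 + L) * (l ^ (a - 1 + ε)) ^ L := by positivity
  refine le_of_mul_le_mul_left ?_ hP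
  calc l ^ (n + 1 + L) * (l ^ (a - 1 + ε)) ^ L * (l ^ n * K * (1 + ‖z‖) ^ (n + 1))
      ≤ l ^ (n + 1 + L) * ‖z‖ ^ L * (l ^ n * K * (2 ^ (n + 1) * ‖z‖ ^ (n + 1))) := by gcongr
    _ = l ^ n * 2 ^ (n + 1) * ((l * ‖z‖) ^ (n + 1 + L) * K) := by ring
    _ ≤ l ^ n * 2 ^ (n + 1) * (C * (2 * l ^ a) ^ (n + 1 + L)) := by
        exact mul_le_mul_of_nonneg_left (h.trans (by gcongr)) (by positivity)
    _ = C * 2 ^ (n + 1 + L) * 2 ^ (n + 1) * (l ^ n * (l ^ a) ^ (n + 1 + L)) := by ring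
    _ ≤ C * 2 ^ (n + 1 + L) * 2 ^ (n + 1) * (l ^ (n + 1 + L) * (l ^ (a - 1 + ε)) ^ L) := by gcongr
    _ = _ := by ring

end KernelTail

end LocalGlobal

end

noncomputable section

namespace LocalGlobal

/-! ### The local estimate on large balls. -/

section Rescaling

variable {n : ℕ} {a s : ℝ} {φ t : EuclideanSpace ℝ (Fin n) → ℝ}
  {u : EuclideanSpace ℝ (Fin n) → ℂ} {Ω : Set (EuclideanSpace ℝ (Fin n))}

theorem UniformBound.exists_lintegral_osc_le (h : UniformBound φ Ω s) :
    ∃ C : ℝ≥0, ∀ t : EuclideanSpace ℝ (Fin n) → ℝ, Measurable t → (∀ x, 0 ≤ t x ∧ t x ≤ 1) →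
      ∀ u, IsTest u → ∫⁻ x in Ω, ‖osc φ t u x‖ₑ ^ 2
        ≤ C * ∫⁻ ξ, ‖(((1 + ‖ξ‖ ^ 2) ^ (s / 2) : ℝ) : ℂ) * u ξ‖ₑ ^ 2 := by
  obtain ⟨C, hC⟩ := h
  refine ⟨C ^ 2, fun t ht ht01 u hu => ?_⟩
  obtain ⟨f, hf⟩ := hu.exists_hat_eq
  obtain rfl : hat f = u := funext hf
  have h := pow_le_pow_left' (hC t ht ht01 f) 2
  rw [mul_pow, eLpNorm_two_sq, sobolevNorm, eLpNorm_two_sq] at h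
  exact_mod_cast h

theorem lintegral_ball_eq (F : EuclideanSpace ℝ (Fin n) → ℝ≥0∞) {ρ : ℝ} (hρ : 0 < ρ)
    (x₀ : EuclideanSpace ℝ (Fin n)) :
    ∫⁻ x in Metric.ball x₀ ρ, F x
      = ENNReal.ofReal (ρ ^ n) * ∫⁻ y in Metric.ball 0 1, F (x₀ + ρ • y) := by
  rw [← lintegral_indicator measurableSet_ball, ← lintegral_indicator measurableSet_ball,
    ← lintegral_add_left_eq_self _ x₀, ← lintegral_comp_smul_eq _ hρ.ne', abs_of_pos hρ]
  congr 1
  refine lintegral_congr fun y => ?_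
  have : x₀ + ρ • y ∈ Metric.ball x₀ ρ ↔ y ∈ Metric.ball (0 : EuclideanSpace ℝ (Fin n)) 1 := by
    simp only [mem_ball_iff_norm, add_sub_cancel_left, sub_zero, norm_smul,
      Real.norm_of_nonneg hρ.le]
    exact mul_lt_iff_lt_one_right hρ
  by_cases h : y ∈ Metric.ball (0 : EuclideanSpace ℝ (Fin n)) 1
  · rw [Set.indicator_of_mem (this.2 h)]
    exact (Set.indicator_of_mem h (fun y => F (x₀ + ρ • y))).symm
  · rw [Set.indicator_of_notMem (mt this.1 h)]
    exact (Set.indicator_of_notMem h (fun y => F (x₀ + ρ • y))).symm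

/-- The scaling symmetry of the propagator: dilating space by `ρ` divides time by `ρ^a`, and moving
the centre to `x₀` is a modulation of `u`, invisible to weighted `L²` norms. -/
theorem IsPhase.osc_rescale (hφ : IsPhase a φ) {ρ : ℝ} (hρ : 0 < ρ)
    (x₀ y : EuclideanSpace ℝ (Fin n)) :
    osc φ (fun y => ρ ^ (-a) * t (x₀ + ρ • y))
        (fun η => Complex.exp (Complex.I * ((⟪x₀, ρ⁻¹ • η⟫ : ℝ) : ℂ)) * u (ρ⁻¹ • η)) y
      = (ρ ^ n : ℝ) * osc φ t u (x₀ + ρ • y) := by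
  have h := Measure.integral_comp_smul (volume : Measure (EuclideanSpace ℝ (Fin n)))
    (fun ξ => Complex.exp (Complex.I * ((⟪x₀ + ρ • y, ξ⟫ + t (x₀ + ρ • y) * φ ξ : ℝ) : ℂ)) * u ξ)
    ρ⁻¹
  rw [finrank_euclideanSpace_fin, abs_of_pos (by positivity), Complex.real_smul, inv_pow,
    inv_inv] at h
  rw [osc, osc, ← h]
  refine integral_congr_ae (Filter.Eventually.of_forall fun η => ?_)
  simp only
  rw [← mul_assoc, ← Complex.exp_add, ← mul_add, ← Complex.ofReal_add,
    hφ.homogeneous _ (inv_pos.2 hρ), Real.inv_rpow hρ.le, Real.rpow_neg hρ.le, inner_add_left,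
    inner_smul_left, inner_smul_right y]
  congr 4
  simp only [conj_trivial]
  field_simp
  ring

theorem IsTest.translate_rescale (hu : IsTest u) {ρ : ℝ} (hρ : 0 < ρ)
    (x₀ : EuclideanSpace ℝ (Fin n)) :
    IsTest fun η => Complex.exp (Complex.I * ((⟪x₀, ρ⁻¹ • η⟫ : ℝ) : ℂ)) * u (ρ⁻¹ • η) := by
  refine (hu.comp_smul (inv_ne_zero hρ.ne')).mul_left ?_
  have h : ContDiff ℝ ∞ fun η : EuclideanSpace ℝ (Fin n) => ⟪x₀, ρ⁻¹ • η⟫ :=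
    contDiff_const.inner ℝ (contDiff_const_smul _)
  exact (contDiff_const.mul (Complex.ofRealCLM.contDiff.comp h)).cexp

/-- The local estimate on unit balls, rescaled to balls of radius `ρ ≥ 1`. -/
theorem IsPhase.exists_lintegral_ball_osc_le (hφ : IsPhase a φ) (ha : 0 ≤ a) (hs : 0 ≤ s)
    (h : UniformBound φ (Metric.ball 0 1) s) :
    ∃ C : ℝ≥0, ∀ ρ R : ℝ, 1 ≤ ρ → 0 ≤ R → ∀ x₀, ∀ t : EuclideanSpace ℝ (Fin n) → ℝ,
      Measurable t → (∀ x, 0 ≤ t x ∧ t x ≤ 1) → ∀ u, IsTest u → (∀ ξ, u ξ ≠ 0 → ‖ξ‖ ≤ R) →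
      ∫⁻ x in Metric.ball x₀ ρ, ‖osc φ t u x‖ₑ ^ 2
        ≤ C * ENNReal.ofReal ((1 + (ρ * R) ^ 2) ^ s) * ∫⁻ ξ, ‖u ξ‖ₑ ^ 2 := by
  obtain ⟨C, hC⟩ := h.exists_lintegral_osc_le
  refine ⟨C, fun ρ R hρ hR x₀ t ht ht01 u hu huR => ?_⟩
  have hρ0 : 0 < ρ := by linarith
  have hρa : ρ ^ (-a) ≤ 1 := Real.rpow_le_one_of_one_le_of_nonpos hρ (by linarith)
  have h1 := hC (fun y => ρ ^ (-a) * t (x₀ + ρ • y)) (by fun_prop)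
    (fun y => ⟨mul_nonneg (by positivity) (ht01 _).1,
      mul_le_one₀ hρa (ht01 _).1 (ht01 _).2⟩) _ (hu.translate_rescale hρ0 x₀)
  simp only [hφ.osc_rescale hρ0, enorm_mul, mul_pow] at h1
  have hρn : ‖((ρ ^ n : ℝ) : ℂ)‖ₑ = ENNReal.ofReal (ρ ^ n) := by
    rw [← ofReal_norm, Complex.norm_real, Real.norm_of_nonneg (by positivity)]
  rw [lintegral_const_mul' _ _ (by finiteness), hρn] at h1
  have hexp : ∀ r : ℝ, ‖Complex.exp (Complex.I * (r : ℂ))‖ₑ = 1 := fun r => by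
    rw [← ofReal_norm, norm_exp_I_mul_ofReal, ENNReal.ofReal_one]
  have h2 : ∫⁻ η, ‖(((1 + ‖η‖ ^ 2) ^ (s / 2) : ℝ) : ℂ)‖ₑ ^ 2 *
      (‖Complex.exp (Complex.I * ((⟪x₀, ρ⁻¹ • η⟫ : ℝ) : ℂ))‖ₑ ^ 2 * ‖u (ρ⁻¹ • η)‖ₑ ^ 2)
      ≤ ENNReal.ofReal ((1 + (ρ * R) ^ 2) ^ s) *
        (ENNReal.ofReal (ρ ^ n) * ∫⁻ ξ, ‖u ξ‖ₑ ^ 2) := by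
    have h3 := lintegral_comp_smul_eq (fun ξ => ‖u ξ‖ₑ ^ 2) (inv_ne_zero hρ0.ne')
    rw [← h3, ← mul_assoc (ENNReal.ofReal (ρ ^ n)), ← ENNReal.ofReal_mul (by positivity),
      abs_of_pos (by positivity), ← mul_pow, mul_inv_cancel₀ hρ0.ne', one_pow, ENNReal.ofReal_one,
      one_mul, ← lintegral_const_mul' _ _ ENNReal.ofReal_ne_top]
    refine lintegral_mono fun η => ?_
    simp only [hexp, one_pow, one_mul]
    by_cases hη : u (ρ⁻¹ • η) = 0
    · simp [hη]
    · gcongr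
      have hle := huR _ hη
      rw [norm_smul, norm_inv, Real.norm_of_nonneg hρ0.le, inv_mul_le_iff₀ hρ0] at hle
      rw [← ofReal_norm, Complex.norm_real, Real.norm_of_nonneg (by positivity),
        ← ENNReal.ofReal_pow (by positivity), ← Real.rpow_mul_natCast (by positivity)]
      refine ENNReal.ofReal_le_ofReal ?_
      rw [Nat.cast_ofNat, div_mul_cancel₀ _ (by norm_num)]
      gcongr
  have hne : ENNReal.ofReal (ρ ^ n) ≠ 0 := by simp; positivity
  rw [lintegral_ball_eq _ hρ0]
  refine (ENNReal.mul_le_mul_iff_right hne ENNReal.ofReal_ne_top).1 ?_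
  calc _ = ENNReal.ofReal (ρ ^ n) ^ 2 *
        ∫⁻ y in Metric.ball 0 1, ‖osc φ t u (x₀ + ρ • y)‖ₑ ^ 2 := by ring
    _ ≤ _ := h1
    _ ≤ C * (ENNReal.ofReal ((1 + (ρ * R) ^ 2) ^ s) *
        (ENNReal.ofReal (ρ ^ n) * ∫⁻ ξ, ‖u ξ‖ₑ ^ 2)) := by gcongr
    _ = _ := by ring

end Rescaling

/-! ### The global estimate at a single frequency scale. -/

section Dyadic

variable {n : ℕ} {a s : ℝ} {φ : EuclideanSpace ℝ (Fin n) → ℝ}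

/-- The integrable weight `(1 + |z|)^{-n-1}`. -/
def tailWeight (n : ℕ) (z : EuclideanSpace ℝ (Fin n)) : ℝ≥0∞ :=
  ENNReal.ofReal ((1 + ‖z‖) ^ (-((n : ℝ) + 1)))

theorem measurable_tailWeight : Measurable (tailWeight n) := by
  unfold tailWeight
  fun_prop

theorem lintegral_tailWeight_ne_top : ∫⁻ z, tailWeight n z ≠ ⊤ := by
  have h := integrable_one_add_norm (E := EuclideanSpace ℝ (Fin n)) (μ := volume)
    (r := (n : ℝ) + 1) (by rw [finrank_euclideanSpace_fin]; linarith)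
  exact h.lintegral_lt_top.ne

theorem osc_mul_hat_eq (hφ : Measurable φ) {χ : EuclideanSpace ℝ (Fin n) → ℂ} (hχ : Integrable χ)
    (t : EuclideanSpace ℝ (Fin n) → ℝ) (G : 𝓢(EuclideanSpace ℝ (Fin n), ℂ))
    (x : EuclideanSpace ℝ (Fin n)) :
    osc φ t (fun ξ => χ ξ * hat G ξ) x
      = ∫ y, (∫ ξ, Complex.exp (Complex.I * ((⟪x - y, ξ⟫ : ℝ) : ℂ)) *
          (Complex.exp (Complex.I * ((t x * φ ξ : ℝ) : ℂ)) * χ ξ)) * G y := by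
  rw [← integral_mul_hat]
  · refine integral_congr_ae (Filter.Eventually.of_forall fun ξ => ?_)
    simp only [Complex.ofReal_add, mul_add, Complex.exp_add]
    ring
  · refine hχ.bdd_mul (c := 1) (by fun_prop) (Filter.Eventually.of_forall fun ξ => ?_)
    rw [norm_exp_I_mul_ofReal]

/-- Data vanishing near `x` meet only the tail of the kernel, whose bound is uniform in the time `t
x`. -/
theorem IsPhase.exists_enorm_osc_far_le (hφ : IsPhase a φ) (ha : 1 ≤ a) {ε : ℝ} (hε : 0 < ε) :
    ∃ C : ℝ≥0, ∀ l : ℝ, 1 ≤ l → ∀ t : EuclideanSpace ℝ (Fin n) → ℝ,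
      (∀ x, 0 ≤ t x ∧ t x ≤ 1) → ∀ G : 𝓢(EuclideanSpace ℝ (Fin n), ℂ), ∀ x,
      (∀ y, ‖x - y‖ < l ^ (a - 1 + ε) → G y = 0) →
      ‖osc φ t (fun ξ => annulus n (l⁻¹ • ξ) * hat G ξ) x‖ₑ
        ≤ C * ∫⁻ y, tailWeight n (x - y) * ‖G y‖ₑ := by
  obtain ⟨C, hC0, hC⟩ := hφ.exists_kernel_tail ha hε
  refine ⟨C.toNNReal, fun l hl t ht G x hG => ?_⟩
  have hl0 : l⁻¹ ≠ 0 := by positivity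
  rw [osc_mul_hat_eq hφ.measurable (isTest_annulus.comp_smul hl0).integrable]
  refine (enorm_integral_le_lintegral_enorm _).trans ?_
  rw [← lintegral_const_mul' _ _ ENNReal.coe_ne_top]
  refine lintegral_mono fun y => ?_
  by_cases hy : G y = 0
  · simp [hy]
  · have hle : l ^ (a - 1 + ε) ≤ ‖x - y‖ := not_lt.1 fun h => hy (hG y h)
    have h := hC l (t x) hl (ht x).1 (ht x).2 (x - y) hle
    rw [enorm_mul, ← mul_assoc]
    gcongr
    rw [← ofReal_norm, tailWeight]
    change _ ≤ ENNReal.ofReal C * _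
    rw [← ENNReal.ofReal_mul hC0]
    exact ENNReal.ofReal_le_ofReal h

theorem hat_add (f g : 𝓢(EuclideanSpace ℝ (Fin n), ℂ)) (ξ : EuclideanSpace ℝ (Fin n)) :
    hat (f + g) ξ = hat f ξ + hat g ξ := by
  simp only [hat, FourierTransform.fourier_add, add_apply]

/-- Splitting a Schwartz function into a part near `x₀` and a part away from `x₀`. -/
theorem exists_near_far (g : 𝓢(EuclideanSpace ℝ (Fin n), ℂ)) (x₀ : EuclideanSpace ℝ (Fin n))
    {ρ : ℝ} (hρ : 0 < ρ) :
    ∃ g₁ g₂ : 𝓢(EuclideanSpace ℝ (Fin n), ℂ), g = g₁ + g₂ ∧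
      (∀ y, ‖g₁ y‖ₑ ≤ (Metric.ball x₀ (3 * ρ)).indicator (fun y => ‖g y‖ₑ) y) ∧
      (∀ y, ‖g₂ y‖ₑ ≤ ‖g y‖ₑ) ∧ ∀ y ∈ Metric.ball x₀ (2 * ρ), g₂ y = 0 := by
  let b : ContDiffBump x₀ := ⟨2 * ρ, 3 * ρ, by positivity, by linarith⟩
  have hb : IsTest fun y => ((b y : ℝ) : ℂ) * g y :=
    ⟨(Complex.ofRealCLM.contDiff.comp b.contDiff).mul (g.smooth ⊤),
      (b.hasCompactSupport.comp_left Complex.ofReal_zero).mul_right⟩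
  let g₁ := hb.hasCompactSupport.toSchwartzMap hb.contDiff
  have hg₁ : ∀ y, g₁ y = ((b y : ℝ) : ℂ) * g y := fun y => rfl
  have hg₂ : ∀ y, (g - g₁) y = ((1 - b y : ℝ) : ℂ) * g y := fun y => by
    rw [sub_apply, hg₁]
    push_cast
    ring
  have hle : ∀ r : ℝ, 0 ≤ r → r ≤ 1 → ∀ z : ℂ, ‖(r : ℂ) * z‖ₑ ≤ ‖z‖ₑ := fun r h0 h1 z => by
    rw [enorm_le_iff_norm_le, norm_mul, Complex.norm_real, Real.norm_of_nonneg h0]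
    exact mul_le_of_le_one_left (norm_nonneg _) h1
  refine ⟨g₁, g - g₁, by abel, fun y => ?_, fun y => ?_, fun y hy => ?_⟩
  · by_cases hy : y ∈ Metric.ball x₀ (3 * ρ)
    · rw [Set.indicator_of_mem hy, hg₁]
      exact hle _ b.nonneg b.le_one _
    · rw [Set.indicator_of_notMem hy, hg₁, b.zero_of_le_dist (by simpa [b] using hy)]
      simp
  · rw [hg₂]
    exact hle _ (by linarith [b.le_one (x := y)]) (by linarith [b.nonneg (x := y)]) _
  · rw [hg₂, b.one_of_mem_closedBall (Metric.ball_subset_closedBall hy)]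
    simp

/-- The data are split at distance comparable to the propagation radius: the rescaled local estimate
controls the near part, the kernel tail the far part. -/
theorem IsPhase.exists_lintegral_ball_osc_le_add (hφ : IsPhase a φ) (ha : 1 ≤ a) {ε : ℝ}
    (hε : 0 < ε) (hs : 0 ≤ s) (h : UniformBound φ (Metric.ball 0 1) s) :
    ∃ A B : ℝ≥0, ∀ l : ℝ, 1 ≤ l → ∀ t : EuclideanSpace ℝ (Fin n) → ℝ,
      Measurable t → (∀ x, 0 ≤ t x ∧ t x ≤ 1) → ∀ g : 𝓢(EuclideanSpace ℝ (Fin n), ℂ),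
      (∀ ξ, hat g ξ ≠ 0 → l / 2 ≤ ‖ξ‖ ∧ ‖ξ‖ ≤ 2 * l) → ∀ x₀,
      ∫⁻ x in Metric.ball x₀ (l ^ (a - 1 + ε)), ‖osc φ t (hat g) x‖ₑ ^ 2
        ≤ A * ENNReal.ofReal (l ^ (2 * ((a + ε) * s))) *
            (∫⁻ y in Metric.ball x₀ (3 * l ^ (a - 1 + ε)), ‖g y‖ₑ ^ 2)
          + B * ∫⁻ x in Metric.ball x₀ (l ^ (a - 1 + ε)),
              (∫⁻ y, tailWeight n (x - y) * ‖g y‖ₑ) ^ 2 := by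
  obtain ⟨C, hC⟩ := hφ.exists_lintegral_ball_osc_le (by linarith) hs h
  obtain ⟨D, hD⟩ := hφ.exists_enorm_osc_far_le ha hε
  -- The near frequencies satisfy `‖ξ‖ ≤ 4l` and `ρl = l^(a+ε) ≥ 1`, so `1 + (4ρl)² ≤ 17
  -- l^(2(a+ε))`; `(2π)^n` comes from Plancherel.
  refine ⟨2 * (C * (17 ^ s : ℝ).toNNReal * ((2 * Real.pi) ^ n).toNNReal), 2 * D ^ 2,
    fun l hl t ht ht01 g hg x₀ => ?_⟩
  have hl0 : 0 < l := by linarith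
  set ρ := l ^ (a - 1 + ε) with hρdef
  have hρ1 : 1 ≤ ρ := Real.one_le_rpow hl (by linarith)
  obtain ⟨g₁, g₂, hg12, hg₁, hg₂, hg₂0⟩ := exists_near_far g x₀ (by linarith : 0 < ρ)
  have hχ := (isTest_annulus (n := n)).comp_smul (c := l⁻¹) (by positivity)
  have htest : ∀ G : 𝓢(EuclideanSpace ℝ (Fin n), ℂ),
      IsTest fun ξ => annulus n (l⁻¹ • ξ) * hat G ξ := fun G =>
    ⟨hχ.contDiff.mul (contDiff_hat G), hχ.hasCompactSupport.mul_right⟩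
  -- Cutting in space destroys frequency localisation. The cutoff `annulus`, harmless on `hat g`,
  -- restores it in each part.
  have hsplit : hat g = fun ξ => annulus n (l⁻¹ • ξ) * hat g₁ ξ + annulus n (l⁻¹ • ξ) * hat g₂ ξ := by
    ext ξ
    rw [← mul_add, ← hat_add, ← hg12]
    by_cases hξ : hat g ξ = 0
    · simp [hξ]
    · obtain ⟨h1, h2⟩ := hg ξ hξ
      rw [annulus_eq_one, one_mul]
      · rw [norm_smul, norm_inv, Real.norm_of_nonneg hl0.le, le_inv_mul_iff₀ hl0]; linarith
      · rw [norm_smul, norm_inv, Real.norm_of_nonneg hl0.le, inv_mul_le_iff₀ hl0]; linarith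
  have hnorm : ∀ ξ, ‖annulus n ξ‖ₑ ≤ 1 := fun ξ => by
    rw [← ofReal_norm, ← ENNReal.ofReal_one]
    exact ENNReal.ofReal_le_ofReal (norm_ofReal_cutoff_sub_le _ _)
  have hnear : ∫⁻ x in Metric.ball x₀ ρ,
      ‖osc φ t (fun ξ => annulus n (l⁻¹ • ξ) * hat g₁ ξ) x‖ₑ ^ 2
      ≤ C * ENNReal.ofReal (17 ^ s * l ^ (2 * ((a + ε) * s))) *
        (ENNReal.ofReal ((2 * Real.pi) ^ n) *
          ∫⁻ y in Metric.ball x₀ (3 * ρ), ‖g y‖ₑ ^ 2) := by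
    refine (hC ρ (4 * l) hρ1 (by positivity) x₀ t ht ht01 _ (htest g₁) fun ξ hξ => ?_).trans ?_
    · have h4 := (of_annulus_ne_zero (left_ne_zero_of_mul hξ)).2
      rw [norm_smul, norm_inv, Real.norm_of_nonneg hl0.le, inv_mul_le_iff₀ hl0] at h4
      linarith
    · have hρl : ρ * l = l ^ (a + ε) := by
        rw [hρdef]
        nth_rewrite 2 [← Real.rpow_one l]
        rw [← Real.rpow_add hl0]
        ring_nf
      have h1le : 1 ≤ l ^ (a + ε) := Real.one_le_rpow hl (by linarith)
      have hpow : (1 + (ρ * (4 * l)) ^ 2) ^ s ≤ 17 ^ s * l ^ (2 * ((a + ε) * s)) := by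
        have : l ^ (2 * ((a + ε) * s)) = ((l ^ (a + ε)) ^ 2) ^ s := by
          rw [← Real.rpow_mul_natCast hl0.le, ← Real.rpow_mul hl0.le]
          congr 1
          push_cast
          ring
        rw [this, ← Real.mul_rpow (by norm_num) (by positivity)]
        refine Real.rpow_le_rpow (by positivity) ?_ hs
        rw [← mul_assoc, mul_comm ρ 4, mul_assoc, hρl]
        nlinarith
      have hL2 : ∫⁻ ξ, ‖annulus n (l⁻¹ • ξ) * hat g₁ ξ‖ₑ ^ 2 ≤
          ENNReal.ofReal ((2 * Real.pi) ^ n) *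
            ∫⁻ y in Metric.ball x₀ (3 * ρ), ‖g y‖ₑ ^ 2 := by
        calc _ ≤ ∫⁻ ξ, ‖hat g₁ ξ‖ₑ ^ 2 := by
              refine lintegral_mono fun ξ => ?_
              rw [enorm_mul]
              exact pow_le_pow_left' (mul_le_of_le_one_left' (hnorm _)) 2
          _ = ENNReal.ofReal ((2 * Real.pi) ^ n) * ∫⁻ y, ‖g₁ y‖ₑ ^ 2 := lintegral_hat_sq g₁
          _ ≤ _ := by
              rw [← lintegral_indicator measurableSet_ball]
              gcongr with y
              refine (pow_le_pow_left' (hg₁ y) 2).trans (le_of_eq ?_)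
              by_cases hy : y ∈ Metric.ball x₀ (3 * ρ) <;> simp [hy]
      gcongr
  -- `g₂` vanishes on the ball of radius `2ρ`, hence at all points within `ρ` of `x`.
  have hfar : ∀ x ∈ Metric.ball x₀ ρ,
      ‖osc φ t (fun ξ => annulus n (l⁻¹ • ξ) * hat g₂ ξ) x‖ₑ
        ≤ D * ∫⁻ y, tailWeight n (x - y) * ‖g y‖ₑ := fun x hx => by
    refine (hD l hl t ht01 g₂ x fun y hy => hg₂0 y ?_).trans ?_
    · rw [Metric.mem_ball] at hx ⊢
      rw [← dist_eq_norm, dist_comm] at hy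
      linarith [dist_triangle y x x₀]
    · gcongr with y
      exact hg₂ y
  have hmeas : Measurable (osc φ t fun ξ => annulus n (l⁻¹ • ξ) * hat g₁ ξ) :=
    (stronglyMeasurable_osc hφ.measurable ht (htest g₁).contDiff.continuous).measurable
  calc ∫⁻ x in Metric.ball x₀ ρ, ‖osc φ t (hat g) x‖ₑ ^ 2
      ≤ ∫⁻ x in Metric.ball x₀ ρ,
          (2 * ‖osc φ t (fun ξ => annulus n (l⁻¹ • ξ) * hat g₁ ξ) x‖ₑ ^ 2
            + 2 * (D * ∫⁻ y, tailWeight n (x - y) * ‖g y‖ₑ) ^ 2) := by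
        refine setLIntegral_mono_ae' measurableSet_ball
          (Filter.Eventually.of_forall fun x hx => ?_)
        rw [hsplit, osc_add hφ.measurable (htest g₁).integrable (htest g₂).integrable]
        refine (enorm_add_sq_le _ _).trans ?_
        gcongr
        exact hfar x hx
    _ = 2 * (∫⁻ x in Metric.ball x₀ ρ,
          ‖osc φ t (fun ξ => annulus n (l⁻¹ • ξ) * hat g₁ ξ) x‖ₑ ^ 2)
        + 2 * (D ^ 2 * ∫⁻ x in Metric.ball x₀ ρ,
            (∫⁻ y, tailWeight n (x - y) * ‖g y‖ₑ) ^ 2) := by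
        rw [lintegral_add_left (by fun_prop), lintegral_const_mul _ (by fun_prop),
          lintegral_const_mul' _ _ (by finiteness)]
        simp only [mul_pow]
        rw [lintegral_const_mul' _ _ (by finiteness)]
    _ ≤ 2 * (C * ENNReal.ofReal (17 ^ s * l ^ (2 * ((a + ε) * s))) *
        (ENNReal.ofReal ((2 * Real.pi) ^ n) *
          ∫⁻ y in Metric.ball x₀ (3 * ρ), ‖g y‖ₑ ^ 2))
        + 2 * (D ^ 2 * ∫⁻ x in Metric.ball x₀ ρ,
            (∫⁻ y, tailWeight n (x - y) * ‖g y‖ₑ) ^ 2) := by gcongr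
    _ = _ := by
        rw [ENNReal.ofReal_mul (by positivity)]
        simp only [ENNReal.coe_mul, ENNReal.coe_pow, ENNReal.coe_ofNat, ENNReal.ofReal]
        ring

/-- The global estimate for functions with frequencies of size `l ≥ 1`. -/
theorem IsPhase.exists_lintegral_osc_annulus_le (hφ : IsPhase a φ) (ha : 1 ≤ a) {ε : ℝ}
    (hε : 0 < ε) (hs : 0 ≤ s) (h : UniformBound φ (Metric.ball 0 1) s) :
    ∃ C : ℝ≥0, ∀ l : ℝ, 1 ≤ l → ∀ t : EuclideanSpace ℝ (Fin n) → ℝ,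
      Measurable t → (∀ x, 0 ≤ t x ∧ t x ≤ 1) → ∀ u, IsTest u →
      (∀ ξ, u ξ ≠ 0 → l / 2 ≤ ‖ξ‖ ∧ ‖ξ‖ ≤ 2 * l) →
      ∫⁻ x, ‖osc φ t u x‖ₑ ^ 2
        ≤ C * ENNReal.ofReal (l ^ (2 * ((a + ε) * s))) * ∫⁻ ξ, ‖u ξ‖ₑ ^ 2 := by
  have hpi := Real.pi_pos
  obtain ⟨A, B, hAB⟩ := hφ.exists_lintegral_ball_osc_le_add ha hε hs h
  set W : ℝ≥0 := (∫⁻ z, tailWeight n z).toNNReal with hW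
  have hWeq : ∫⁻ z, tailWeight n z = W := (ENNReal.coe_toNNReal lintegral_tailWeight_ne_top).symm
  refine ⟨A * 3 ^ n + B * W ^ 2, fun l hl t ht ht01 u hu hul => ?_⟩
  obtain ⟨g, hg⟩ := hu.exists_hat_eq
  obtain rfl : hat g = u := funext hg
  set ρ := l ^ (a - 1 + ε) with hρdef
  have hρ1 : 1 ≤ ρ := Real.one_le_rpow hl (by linarith)
  set L := ENNReal.ofReal (l ^ (2 * ((a + ε) * s))) with hLdef
  have hL : 1 ≤ L := by
    rw [hLdef, ← ENNReal.ofReal_one]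
    exact ENNReal.ofReal_le_ofReal (Real.one_le_rpow hl (by positivity))
  have hTm : Measurable fun x => ‖osc φ t (hat g) x‖ₑ ^ 2 :=
    ((stronglyMeasurable_osc hφ.measurable ht hu.contDiff.continuous).measurable.enorm).pow_const 2
  have hgm : Measurable fun y => ‖g y‖ₑ := g.continuous.measurable.enorm
  have hWm := measurable_tailWeight (n := n)
  have hYm : Measurable fun x => (∫⁻ y, tailWeight n (x - y) * ‖g y‖ₑ) ^ 2 :=
    (Measurable.lintegral_prod_right' ((hWm.comp (measurable_fst.sub measurable_snd)).mul
      (hgm.comp measurable_snd))).pow_const 2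
  set V := volume (Metric.ball (0 : EuclideanSpace ℝ (Fin n)) ρ) with hV
  have hV0 : V ≠ 0 := (Metric.measure_ball_pos _ _ (by linarith)).ne'
  have hVtop : V ≠ ⊤ := measure_ball_lt_top.ne
  have hg2 : ∫⁻ y, ‖g y‖ₑ ^ 2 ≤ ∫⁻ ξ, ‖hat g ξ‖ₑ ^ 2 := by
    rw [lintegral_hat_sq]
    refine le_mul_of_one_le_left' ?_
    rw [← ENNReal.ofReal_one]
    exact ENNReal.ofReal_le_ofReal (one_le_pow₀ (by linarith [Real.pi_gt_three]))
  have hball : Measurable fun x₀ => ∫⁻ y in Metric.ball x₀ (3 * ρ), ‖g y‖ₑ ^ 2 := by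
    have hS : MeasurableSet {p : EuclideanSpace ℝ (Fin n) × EuclideanSpace ℝ (Fin n) |
        dist p.2 p.1 < 3 * ρ} :=
      measurableSet_lt (measurable_snd.dist measurable_fst) measurable_const
    have hm := (((hgm.pow_const 2).comp measurable_snd).indicator hS).lintegral_prod_right'
      (ν := (volume : Measure (EuclideanSpace ℝ (Fin n))))
    convert hm using 2 with x₀
    rw [← lintegral_indicator measurableSet_ball]
    rfl
  -- Averaging over centres produces the volume `V` of a `ρ`-ball on the left and `3^n V` or `V` on
  -- the right, so `V` cancels and the constant does not depend on `ρ`.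
  refine (ENNReal.mul_le_mul_iff_right hV0 hVtop).1 ?_
  calc V * ∫⁻ x, ‖osc φ t (hat g) x‖ₑ ^ 2
      = ∫⁻ x₀, ∫⁻ x in Metric.ball x₀ ρ, ‖osc φ t (hat g) x‖ₑ ^ 2 :=
        (lintegral_lintegral_ball hTm ρ).symm
    _ ≤ ∫⁻ x₀, (A * L * (∫⁻ y in Metric.ball x₀ (3 * ρ), ‖g y‖ₑ ^ 2)
          + B * ∫⁻ x in Metric.ball x₀ ρ, (∫⁻ y, tailWeight n (x - y) * ‖g y‖ₑ) ^ 2) :=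
        lintegral_mono fun x₀ => hAB l hl t ht ht01 g hul x₀
    _ = A * L * (ENNReal.ofReal (3 ^ n) * V * ∫⁻ y, ‖g y‖ₑ ^ 2)
          + B * (V * ∫⁻ x, (∫⁻ y, tailWeight n (x - y) * ‖g y‖ₑ) ^ 2) := by
        rw [lintegral_add_left (hball.const_mul _), lintegral_const_mul _ hball,
          lintegral_const_mul' _ _ ENNReal.coe_ne_top, lintegral_lintegral_ball hYm,
          lintegral_lintegral_ball (hgm.pow_const 2), volume_ball_mul _ (by norm_num)]
    _ ≤ A * L * (ENNReal.ofReal (3 ^ n) * V * ∫⁻ y, ‖g y‖ₑ ^ 2)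
          + B * (V * (L * (W ^ 2 * ∫⁻ y, ‖g y‖ₑ ^ 2))) := by
        gcongr
        refine (lintegral_sq_convolution_le hWm hgm).trans ?_
        rw [hWeq]
        exact le_mul_of_one_le_left' hL
    _ = V * ((A * 3 ^ n + B * W ^ 2) * L * ∫⁻ y, ‖g y‖ₑ ^ 2) := by
        rw [ENNReal.ofReal_pow (by norm_num), ENNReal.ofReal_ofNat]
        ring
    _ ≤ _ := by
        push_cast
        gcongr

end Dyadic

end LocalGlobal

end

noncomputable section

namespace LocalGlobal

/-! ### Bounded frequencies, without the local hypothesis. -/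

section LowFrequency

variable {n : ℕ} {a : ℝ} {φ ψ : EuclideanSpace ℝ (Fin n) → ℝ} {u : EuclideanSpace ℝ (Fin n) → ℂ}

theorem exp_sub_one_eq_setIntegral (r : ℝ) {τ : ℝ} (hτ : 0 ≤ τ) :
    Complex.exp (Complex.I * ((τ * r : ℝ) : ℂ)) - 1
      = ∫ σ in Set.Ioc 0 τ, Complex.exp (Complex.I * ((σ * r : ℝ) : ℂ)) * (Complex.I * r) := by
  have hderiv : ∀ σ : ℝ, HasDerivAt (fun σ : ℝ => Complex.exp (Complex.I * ((σ * r : ℝ) : ℂ)))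
      (Complex.exp (Complex.I * ((σ * r : ℝ) : ℂ)) * (Complex.I * r)) σ := fun σ => by
    have h1 : HasDerivAt (fun σ : ℝ => ((σ * r : ℝ) : ℂ)) ((1 * r : ℝ) : ℂ) σ :=
      ((hasDerivAt_id σ).mul_const r).ofReal_comp
    simpa using (h1.const_mul Complex.I).cexp
  rw [← intervalIntegral.integral_of_le hτ, intervalIntegral.integral_eq_sub_of_hasDerivAt
    (fun σ _ => hderiv σ) (Continuous.intervalIntegrable (by fun_prop) _ _)]
  simp

/-- The spatial Fourier integral of `e^{iσψ} iψ u`, the time derivative of the propagator. -/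
def oscDeriv (ψ : EuclideanSpace ℝ (Fin n) → ℝ) (u : EuclideanSpace ℝ (Fin n) → ℂ) (σ : ℝ)
    (x : EuclideanSpace ℝ (Fin n)) : ℂ :=
  ∫ ξ, Complex.exp (Complex.I * ((⟪x, ξ⟫ : ℝ) : ℂ)) *
    (Complex.exp (Complex.I * ((σ * ψ ξ : ℝ) : ℂ)) * (Complex.I * ψ ξ * u ξ))

theorem IsTest.I_mul (hu : IsTest u) (hψ : ContDiff ℝ ∞ ψ) :
    IsTest fun ξ => Complex.I * ψ ξ * u ξ :=
  hu.mul_left (contDiff_const.mul (Complex.ofRealCLM.contDiff.comp hψ))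

/-- The fundamental theorem of calculus in time, under the frequency integral. The `x`-dependent
time survives only as an upper limit of integration. -/
theorem osc_eq_add_setIntegral (hψ : ContDiff ℝ ∞ ψ) (hu : IsTest u)
    {t : EuclideanSpace ℝ (Fin n) → ℝ} {x : EuclideanSpace ℝ (Fin n)} (ht : 0 ≤ t x) :
    osc ψ t u x = (∫ ξ, Complex.exp (Complex.I * ((⟪x, ξ⟫ : ℝ) : ℂ)) * u ξ)
      + ∫ σ in Set.Ioc 0 (t x), oscDeriv ψ u σ x := by
  have hψm : Measurable ψ := hψ.continuous.measurable
  have hint : Integrable (Function.uncurry fun (σ : ℝ) ξ =>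
      Complex.exp (Complex.I * ((⟪x, ξ⟫ : ℝ) : ℂ)) *
        (Complex.exp (Complex.I * ((σ * ψ ξ : ℝ) : ℂ)) * (Complex.I * ψ ξ * u ξ)))
      ((volume.restrict (Set.Ioc 0 (t x))).prod volume) := by
    have h1 : Integrable (fun p : ℝ × EuclideanSpace ℝ (Fin n) =>
        (1 : ℂ) * (Complex.I * ψ p.2 * u p.2))
        ((volume.restrict (Set.Ioc 0 (t x))).prod volume) :=
      (integrable_const (1 : ℂ)).mul_prod (hu.I_mul hψ).integrable
    simp only [one_mul] at h1
    have h2 := h1.bdd_mul (c := 1) (f := fun p : ℝ × EuclideanSpace ℝ (Fin n) =>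
      Complex.exp (Complex.I * ((p.1 * ψ p.2 : ℝ) : ℂ))) (by fun_prop)
      (Filter.Eventually.of_forall fun p => by rw [norm_exp_I_mul_ofReal])
    exact h2.bdd_mul (c := 1) (f := fun p : ℝ × EuclideanSpace ℝ (Fin n) =>
      Complex.exp (Complex.I * ((⟪x, p.2⟫ : ℝ) : ℂ))) (by fun_prop)
      (Filter.Eventually.of_forall fun p => by rw [norm_exp_I_mul_ofReal])
  have hx : Integrable fun ξ => Complex.exp (Complex.I * ((⟪x, ξ⟫ : ℝ) : ℂ)) * u ξ :=
    hu.integrable.bdd_mul (c := 1) (by fun_prop)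
      (Filter.Eventually.of_forall fun ξ => by rw [norm_exp_I_mul_ofReal])
  simp only [oscDeriv]
  rw [integral_integral_swap hint, ← sub_eq_iff_eq_add', osc,
    ← integral_sub (integrable_osc hψm hu.integrable x) hx]
  refine integral_congr_ae (Filter.Eventually.of_forall fun ξ => ?_)
  simp only
  have h : ∀ σ : ℝ, Complex.exp (Complex.I * ((⟪x, ξ⟫ : ℝ) : ℂ)) *
      (Complex.exp (Complex.I * ((σ * ψ ξ : ℝ) : ℂ)) * (Complex.I * ψ ξ * u ξ))
      = (Complex.exp (Complex.I * ((⟪x, ξ⟫ : ℝ) : ℂ)) * u ξ) *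
        (Complex.exp (Complex.I * ((σ * ψ ξ : ℝ) : ℂ)) * (Complex.I * ψ ξ)) := fun σ => by ring
  simp only [h]
  rw [integral_const_mul, ← exp_sub_one_eq_setIntegral _ ht, Complex.ofReal_add, mul_add,
    Complex.exp_add]
  ring

theorem measurable_oscDeriv (hψ : ContDiff ℝ ∞ ψ) (hu : IsTest u) :
    Measurable fun p : ℝ × EuclideanSpace ℝ (Fin n) => oscDeriv ψ u p.1 p.2 := by
  have hψm : Measurable ψ := hψ.continuous.measurable
  have hum : Measurable u := hu.contDiff.continuous.measurable
  refine StronglyMeasurable.measurable (StronglyMeasurable.integral_prod_right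
    (f := fun (p : ℝ × EuclideanSpace ℝ (Fin n)) ξ =>
      Complex.exp (Complex.I * ((⟪p.2, ξ⟫ : ℝ) : ℂ)) *
        (Complex.exp (Complex.I * ((p.1 * ψ ξ : ℝ) : ℂ)) * (Complex.I * ψ ξ * u ξ))) ?_)
  apply Measurable.stronglyMeasurable
  simp only [Function.uncurry_def]
  fun_prop

theorem lintegral_oscDeriv_sq (hψ : ContDiff ℝ ∞ ψ) (hu : IsTest u) (σ : ℝ) :
    ∫⁻ x, ‖oscDeriv ψ u σ x‖ₑ ^ 2
      = ENNReal.ofReal ((2 * Real.pi) ^ n) * ∫⁻ ξ, ‖(ψ ξ : ℂ) * u ξ‖ₑ ^ 2 := by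
  have hexp : ∀ r : ℝ, ‖Complex.exp (Complex.I * (r : ℂ))‖ₑ = 1 := fun r => by
    rw [← ofReal_norm, norm_exp_I_mul_ofReal, ENNReal.ofReal_one]
  have hI : ‖Complex.I‖ₑ = 1 := by rw [← ofReal_norm, Complex.norm_I, ENNReal.ofReal_one]
  refine (((hu.I_mul hψ).mul_left (contDiff_exp_I_mul_comp hψ σ)).lintegral_inverse_sq).trans ?_
  simp only [enorm_mul, hexp, hI, one_mul]

/-- Enlarging the interval to `(0, 1]` removes the dependence on `τ`; Cauchy–Schwarz on an interval
of length one does the rest. -/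
theorem enorm_setIntegral_sq_le {F : ℝ → ℂ} (hF : Measurable F) {τ : ℝ} (hτ : τ ≤ 1) :
    ‖∫ σ in Set.Ioc 0 τ, F σ‖ₑ ^ 2 ≤ ∫⁻ σ in Set.Ioc 0 1, ‖F σ‖ₑ ^ 2 := by
  have h1 : ‖∫ σ in Set.Ioc 0 τ, F σ‖ₑ ≤ ∫⁻ σ in Set.Ioc 0 1, 1 * ‖F σ‖ₑ := by
    simp only [one_mul]
    exact (enorm_integral_le_lintegral_enorm _).trans
      (lintegral_mono_set (Set.Ioc_subset_Ioc_right hτ))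
  refine (pow_le_pow_left' h1 2).trans ((sq_lintegral_mul_le aemeasurable_const
    hF.enorm.aemeasurable).trans ?_)
  simp

/-- Plancherel fails for a time depending on `x` but holds at each fixed `σ`. The price for
arbitrary `t` is one time derivative, that is, one factor `ψ`. -/
theorem lintegral_osc_sq_le_of_contDiff (hψ : ContDiff ℝ ∞ ψ) (hu : IsTest u)
    {t : EuclideanSpace ℝ (Fin n) → ℝ} (ht : ∀ x, 0 ≤ t x ∧ t x ≤ 1) :
    ∫⁻ x, ‖osc ψ t u x‖ₑ ^ 2 ≤ 2 * (ENNReal.ofReal ((2 * Real.pi) ^ n) * ∫⁻ ξ, ‖u ξ‖ₑ ^ 2)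
      + 2 * (ENNReal.ofReal ((2 * Real.pi) ^ n) * ∫⁻ ξ, ‖(ψ ξ : ℂ) * u ξ‖ₑ ^ 2) := by
  have hm := measurable_oscDeriv hψ hu
  have hmeas : Measurable fun x => ∫⁻ σ in Set.Ioc (0 : ℝ) 1, ‖oscDeriv ψ u σ x‖ₑ ^ 2 :=
    Measurable.lintegral_prod_left' (hm.enorm.pow_const 2)
  calc ∫⁻ x, ‖osc ψ t u x‖ₑ ^ 2
      ≤ ∫⁻ x, (2 * ‖∫ ξ, Complex.exp (Complex.I * ((⟪x, ξ⟫ : ℝ) : ℂ)) * u ξ‖ₑ ^ 2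
          + 2 * ∫⁻ σ in Set.Ioc 0 1, ‖oscDeriv ψ u σ x‖ₑ ^ 2) := by
        refine lintegral_mono fun x => ?_
        rw [osc_eq_add_setIntegral hψ hu (ht x).1]
        refine (enorm_add_sq_le _ _).trans ?_
        gcongr
        exact enorm_setIntegral_sq_le (hm.comp measurable_prodMk_right) (ht x).2
    _ = 2 * (∫⁻ x, ‖∫ ξ, Complex.exp (Complex.I * ((⟪x, ξ⟫ : ℝ) : ℂ)) * u ξ‖ₑ ^ 2)
          + 2 * ∫⁻ x, ∫⁻ σ in Set.Ioc 0 1, ‖oscDeriv ψ u σ x‖ₑ ^ 2 := by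
        rw [lintegral_add_right _ (hmeas.const_mul 2), lintegral_const_mul' _ _ (by simp),
          lintegral_const_mul' _ _ (by simp)]
    _ = _ := by
        rw [hu.lintegral_inverse_sq, lintegral_lintegral_swap
          (f := fun x σ => ‖oscDeriv ψ u σ x‖ₑ ^ 2) ((hm.enorm.pow_const 2).comp measurable_swap).aemeasurable]
        simp only [lintegral_oscDeriv_sq hψ hu]
        simp

/-- The global estimate for bounded frequencies. -/
theorem IsPhase.exists_lintegral_osc_low_le (hφ : IsPhase a φ) (ha : 0 ≤ a) :
    ∃ C : ℝ≥0, ∀ t : EuclideanSpace ℝ (Fin n) → ℝ, (∀ x, 0 ≤ t x ∧ t x ≤ 1) →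
      ∀ u, IsTest u → ∀ r : ℝ, 0 < r → (∀ ξ, u ξ ≠ 0 → r ≤ ‖ξ‖ ∧ ‖ξ‖ ≤ 2) →
      ∫⁻ x, ‖osc φ t u x‖ₑ ^ 2 ≤ C * ∫⁻ ξ, ‖u ξ‖ₑ ^ 2 := by
  obtain ⟨D, hD⟩ := hφ.deriv_bound 0
  set B : ℝ≥0 := (|D| * 2 ^ a).toNNReal with hB
  set P : ℝ≥0 := ((2 * Real.pi) ^ n).toNNReal with hP
  refine ⟨2 * P + 2 * P * B ^ 2, fun t ht u hu r hr hur => ?_⟩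
  -- `ψ` depends on `r`, but the estimate sees it only through its values on the support of `u`,
  -- bounded by `|D| 2^a`. The constant is thus uniform in `r`, as needed when `J → ∞`.
  obtain ⟨ψ, hψ, -, hψφ⟩ := hφ.exists_smooth_eq_on_annulus hr (by norm_num : (0 : ℝ) < 2)
  have heq : osc φ t u = osc ψ t u :=
    osc_congr_of_forall fun ξ hξ => (hψφ ξ (hur ξ hξ).1 (hur ξ hξ).2).symm
  have hle : ∫⁻ ξ, ‖(ψ ξ : ℂ) * u ξ‖ₑ ^ 2 ≤ B ^ 2 * ∫⁻ ξ, ‖u ξ‖ₑ ^ 2 := by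
    rw [← lintegral_const_mul' _ _ (by finiteness)]
    refine lintegral_mono fun ξ => ?_
    by_cases hξ : u ξ = 0
    · simp [hξ]
    · obtain ⟨h1, h2⟩ := hur ξ hξ
      rw [enorm_mul, mul_pow]
      gcongr
      rw [hψφ ξ h1 h2, ← ofReal_norm, Complex.norm_real]
      change _ ≤ ENNReal.ofReal _
      refine ENNReal.ofReal_le_ofReal ?_
      have h := hD ξ (norm_pos_iff.1 (hr.trans_le h1))
      rw [norm_iteratedFDeriv_zero, Nat.cast_zero, sub_zero] at h
      refine h.trans ?_
      gcongr
      exact le_abs_self D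
  rw [heq]
  refine (lintegral_osc_sq_le_of_contDiff hψ hu ht).trans ?_
  change 2 * ((P : ℝ≥0∞) * _) + 2 * ((P : ℝ≥0∞) * _) ≤ _
  calc _ ≤ 2 * (P * ∫⁻ ξ, ‖u ξ‖ₑ ^ 2) + 2 * (P * (B ^ 2 * ∫⁻ ξ, ‖u ξ‖ₑ ^ 2)) := by gcongr
    _ = _ := by push_cast; ring

end LowFrequency

/-! ### Summation over dyadic frequencies and removal of the truncation. -/

section Summation

variable {n : ℕ} {a s σ : ℝ} {φ : EuclideanSpace ℝ (Fin n) → ℝ}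

theorem eLpNorm_two_le_of_lintegral_sq_le {α F G : Type*} [MeasurableSpace α]
    [NormedAddCommGroup F] [NormedAddCommGroup G] {μ ν : Measure α} {f : α → F} {g : α → G}
    {C : ℝ≥0∞} (h : ∫⁻ x, ‖f x‖ₑ ^ 2 ∂μ ≤ C ^ 2 * ∫⁻ x, ‖g x‖ₑ ^ 2 ∂ν) :
    eLpNorm f 2 μ ≤ C * eLpNorm g 2 ν := by
  rw [← eLpNorm_two_sq, ← eLpNorm_two_sq, ← mul_pow] at h
  exact (ENNReal.pow_le_pow_left_iff two_ne_zero).1 h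

/-- The frequency truncation `2^{-J} ≲ |ξ| ≲ 2^K` of `f̂`. -/
def truncHat (f : 𝓢(EuclideanSpace ℝ (Fin n), ℂ)) (J K : ℕ) (ξ : EuclideanSpace ℝ (Fin n)) : ℂ :=
  (((cutoff n (((2 : ℝ) ^ K)⁻¹ • ξ) : ℝ) : ℂ) - ((cutoff n ((2 : ℝ) ^ J • ξ) : ℝ) : ℂ)) * hat f ξ

/-- The part of `f̂` with `|ξ| ∼ 2^{k+1}`. -/
def dyadicHat (f : 𝓢(EuclideanSpace ℝ (Fin n), ℂ)) (k : ℕ) (ξ : EuclideanSpace ℝ (Fin n)) : ℂ :=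
  (((cutoff n (((2 : ℝ) ^ (k + 1))⁻¹ • ξ) : ℝ) : ℂ)
    - ((cutoff n (((2 : ℝ) ^ k)⁻¹ • ξ) : ℝ) : ℂ)) * hat f ξ

variable (f : 𝓢(EuclideanSpace ℝ (Fin n), ℂ))

theorem isTest_cutoff_sub_mul_hat {c d : ℝ} (hc : c ≠ 0) (hd : d ≠ 0) :
    IsTest fun ξ => (((cutoff n (c • ξ) : ℝ) : ℂ) - ((cutoff n (d • ξ) : ℝ) : ℂ)) * hat f ξ := by
  have h := (isTest_cutoff_smul (n := n) hc).sub (isTest_cutoff_smul hd)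
  exact ⟨h.contDiff.mul (contDiff_hat f), h.hasCompactSupport.mul_right⟩

theorem isTest_truncHat (J K : ℕ) : IsTest (truncHat f J K) :=
  isTest_cutoff_sub_mul_hat f (by positivity) (by positivity)

theorem isTest_dyadicHat (k : ℕ) : IsTest (dyadicHat f k) :=
  isTest_cutoff_sub_mul_hat f (by positivity) (by positivity)

theorem truncHat_succ (J K : ℕ) :
    truncHat f J (K + 1) = fun ξ => truncHat f J K ξ + dyadicHat f K ξ := by
  ext ξ
  simp only [truncHat, dyadicHat]
  ring

theorem of_cutoff_sub_ne_zero {c d : ℝ} (hc : 0 < c) (hd : 0 < d) (hcd : c ≤ d)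
    {ξ : EuclideanSpace ℝ (Fin n)}
    (h : (((cutoff n (c • ξ) : ℝ) : ℂ) - ((cutoff n (d • ξ) : ℝ) : ℂ)) ≠ 0) :
    d⁻¹ ≤ ‖ξ‖ ∧ ‖ξ‖ ≤ 2 * c⁻¹ := by
  by_contra hcon
  refine h ?_
  rw [not_and_or, not_le, not_le] at hcon
  have hc' : ‖c • ξ‖ = c * ‖ξ‖ := by rw [norm_smul, Real.norm_of_nonneg hc.le]
  have hd' : ‖d • ξ‖ = d * ‖ξ‖ := by rw [norm_smul, Real.norm_of_nonneg hd.le]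
  have hmul : c * ‖ξ‖ ≤ d * ‖ξ‖ := by gcongr
  rcases hcon with hlt | hlt
  · have h1 : d * ‖ξ‖ < 1 := by rwa [← lt_inv_mul_iff₀ hd, mul_one]
    rw [cutoff_eq_one (by linarith), cutoff_eq_one (by linarith), sub_self]
  · have h1 : 2 < c * ‖ξ‖ := by rwa [← div_eq_mul_inv, div_lt_iff₀' hc] at hlt
    rw [cutoff_eq_zero (by linarith), cutoff_eq_zero (by linarith), sub_self]

theorem eLpNorm_truncHat_zero_le (hs : 0 ≤ s) (J : ℕ) :
    eLpNorm (truncHat f J 0) 2 volume ≤ sobolevNorm s f := by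
  refine eLpNorm_mono fun ξ => ?_
  rw [truncHat, norm_mul, norm_mul, Complex.norm_real, Real.norm_of_nonneg (by positivity)]
  gcongr
  exact (norm_ofReal_cutoff_sub_le _ _).trans
    (Real.one_le_rpow (by linarith [sq_nonneg ‖ξ‖]) (by positivity))

/-- On the support `‖ξ‖ ≥ 2^k`, so the Sobolev weight is at least `2^(ks)`. -/
theorem eLpNorm_dyadicHat_le (hs : 0 ≤ s) (k : ℕ) :
    eLpNorm (dyadicHat f k) 2 volume
      ≤ ENNReal.ofReal (((2 : ℝ) ^ k) ^ (-s)) * sobolevNorm s f := by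
  refine eLpNorm_le_mul_eLpNorm_of_ae_le_mul (Filter.Eventually.of_forall fun ξ => ?_) 2
  rw [dyadicHat, norm_mul, norm_mul, Complex.norm_real, Real.norm_of_nonneg (by positivity),
    ← mul_assoc]
  by_cases h : (((cutoff n (((2 : ℝ) ^ (k + 1))⁻¹ • ξ) : ℝ) : ℂ)
    - ((cutoff n (((2 : ℝ) ^ k)⁻¹ • ξ) : ℝ) : ℂ)) = 0
  · rw [h, norm_zero, zero_mul]
    positivity
  · gcongr
    refine (norm_ofReal_cutoff_sub_le _ _).trans ?_
    have h1 := (of_cutoff_sub_ne_zero (by positivity) (by positivity)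
      (inv_anti₀ (by positivity) (pow_le_pow_right₀ (by norm_num) k.le_succ)) h).1
    rw [inv_inv] at h1
    have h2 : ((2 : ℝ) ^ k) ^ s ≤ (1 + ‖ξ‖ ^ 2) ^ (s / 2) := by
      calc ((2 : ℝ) ^ k) ^ s = (((2 : ℝ) ^ k) ^ 2) ^ (s / 2) := by
            rw [← Real.rpow_natCast ((2 : ℝ) ^ k) 2, ← Real.rpow_mul (by positivity)]
            congr 1
            push_cast
            ring
        _ ≤ _ := by
            refine Real.rpow_le_rpow (by positivity) ?_ (by positivity)
            have : ((2 : ℝ) ^ k) ^ 2 ≤ ‖ξ‖ ^ 2 := by gcongr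
            linarith
    rw [Real.rpow_neg (by positivity), inv_mul_eq_div, le_div_iff₀ (by positivity), one_mul]
    exact h2

/-- Summation of the dyadic estimates, when there is room in the exponent. -/
theorem exists_eLpNorm_osc_truncHat_le (hφ : IsPhase a φ) (ha : 0 ≤ a) (hs : 0 ≤ s) (hσ : σ < s)
    (h : ∃ C : ℝ≥0, ∀ l : ℝ, 1 ≤ l → ∀ t : EuclideanSpace ℝ (Fin n) → ℝ,
      Measurable t → (∀ x, 0 ≤ t x ∧ t x ≤ 1) → ∀ u, IsTest u →
      (∀ ξ, u ξ ≠ 0 → l / 2 ≤ ‖ξ‖ ∧ ‖ξ‖ ≤ 2 * l) →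
      ∫⁻ x, ‖osc φ t u x‖ₑ ^ 2 ≤ C * ENNReal.ofReal (l ^ (2 * σ)) * ∫⁻ ξ, ‖u ξ‖ₑ ^ 2) :
    ∃ C : ℝ≥0, ∀ t : EuclideanSpace ℝ (Fin n) → ℝ, Measurable t → (∀ x, 0 ≤ t x ∧ t x ≤ 1) →
      ∀ (f : 𝓢(EuclideanSpace ℝ (Fin n), ℂ)) (J K : ℕ),
        eLpNorm (osc φ t (truncHat f J K)) 2 volume ≤ C * sobolevNorm s f := by
  obtain ⟨C, hC⟩ := h
  obtain ⟨D, hD⟩ := hφ.exists_lintegral_osc_low_le ha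
  -- `c + 1` serves as a cheap substitute for the square root of `c`.
  have hsq : ∀ c : ℝ≥0, (c : ℝ≥0∞) ≤ ((c + 1 : ℝ≥0) : ℝ≥0∞) ^ 2 := fun c => by
    have : c ≤ (c + 1) ^ 2 := by
      calc c ≤ c + 1 := le_self_add
        _ ≤ (c + 1) ^ 2 := le_self_pow₀ le_add_self two_ne_zero
    exact_mod_cast this
  set q : ℝ := 2 ^ (σ - s) with hq
  have hq0 : 0 < q := by positivity
  have hq1 : q < 1 := Real.rpow_lt_one_of_one_lt_of_neg (by norm_num) (by linarith)
  set E : ℝ := (C + 1) * 2 ^ σ with hE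
  have hE0 : 0 ≤ E := by positivity
  have hq' : 0 < 1 - q := by linarith
  -- The `k`-th piece has `l = 2^(k+1)` and norm at most `E q^k` times the Sobolev norm. The
  -- induction carries the exact partial sum `E (1 - q^K) / (1 - q)`, which stays bounded because `σ
  -- < s`.
  have key : ∀ t : EuclideanSpace ℝ (Fin n) → ℝ, Measurable t → (∀ x, 0 ≤ t x ∧ t x ≤ 1) →
      ∀ (f : 𝓢(EuclideanSpace ℝ (Fin n), ℂ)) (J K : ℕ),
        eLpNorm (osc φ t (truncHat f J K)) 2 volume
          ≤ ENNReal.ofReal ((D + 1) + E / (1 - q) * (1 - q ^ K)) * sobolevNorm s f := by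
    intro t ht ht01 f J K
    induction K with
    | zero =>
      rw [pow_zero, sub_self, mul_zero, add_zero]
      have h0 := hD t ht01 _ (isTest_truncHat f J 0) ((2 ^ J)⁻¹) (by positivity) fun ξ hξ => by
        have h1 := of_cutoff_sub_ne_zero (by positivity) (by positivity) (by
          rw [pow_zero, inv_one]; exact one_le_pow₀ (by norm_num)) (left_ne_zero_of_mul hξ)
        simpa using h1
      have h1 : eLpNorm (osc φ t (truncHat f J 0)) 2 volume
          ≤ ((D + 1 : ℝ≥0) : ℝ≥0∞) * eLpNorm (truncHat f J 0) 2 volume :=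
        eLpNorm_two_le_of_lintegral_sq_le (h0.trans (by gcongr; exact hsq D))
      refine h1.trans ?_
      have h2 : ENNReal.ofReal ((D : ℝ) + 1) = ((D + 1 : ℝ≥0) : ℝ≥0∞) := by
        rw [← ENNReal.ofReal_coe_nnreal]; push_cast; rfl
      rw [h2]
      gcongr
      exact eLpNorm_truncHat_zero_le f hs J
    | succ K ih =>
      have hdy : eLpNorm (osc φ t (dyadicHat f K)) 2 volume
          ≤ ENNReal.ofReal (E * q ^ K) * sobolevNorm s f := by
        have h0 := hC (2 ^ (K + 1)) (one_le_pow₀ (by norm_num)) t ht ht01 _ (isTest_dyadicHat f K)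
          fun ξ hξ => by
            have h1 := of_cutoff_sub_ne_zero (by positivity) (by positivity)
              (inv_anti₀ (by positivity) (pow_le_pow_right₀ (by norm_num) K.le_succ))
              (left_ne_zero_of_mul hξ)
            rw [inv_inv, inv_inv] at h1
            exact ⟨by rw [pow_succ]; linarith [h1.1], h1.2⟩
        have h1 : eLpNorm (osc φ t (dyadicHat f K)) 2 volume
            ≤ (((C + 1 : ℝ≥0) : ℝ≥0∞) * ENNReal.ofReal (((2 : ℝ) ^ (K + 1)) ^ σ))
              * eLpNorm (dyadicHat f K) 2 volume := by
          refine eLpNorm_two_le_of_lintegral_sq_le (h0.trans ?_)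
          rw [mul_pow, ← ENNReal.ofReal_pow (by positivity), ← Real.rpow_mul_natCast (by positivity),
            Nat.cast_ofNat, mul_comm σ 2]
          gcongr
          exact hsq C
        refine h1.trans ((mul_le_mul_right (eLpNorm_dyadicHat_le f hs K) _).trans (le_of_eq ?_))
        have h2 : ((C + 1 : ℝ≥0) : ℝ≥0∞) = ENNReal.ofReal ((C : ℝ) + 1) := by
          rw [← ENNReal.ofReal_coe_nnreal]; push_cast; rfl
        rw [h2, ← mul_assoc, ← ENNReal.ofReal_mul (by positivity),
          ← ENNReal.ofReal_mul (by positivity)]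
        congr 2
        rw [hE, hq, pow_succ, Real.mul_rpow (by positivity) (by norm_num),
          ← Real.rpow_natCast ((2 : ℝ) ^ (σ - s)), ← Real.rpow_natCast (2 : ℝ) K,
          ← Real.rpow_mul (by norm_num), ← Real.rpow_mul (by norm_num),
          ← Real.rpow_mul (by norm_num)]
        have : (2 : ℝ) ^ ((σ - s) * K) = 2 ^ ((K : ℝ) * σ) * 2 ^ ((K : ℝ) * -s) := by
          rw [← Real.rpow_add (by norm_num)]
          ring_nf
        rw [this]
        ring
      have hadd : osc φ t (truncHat f J (K + 1))
          = osc φ t (truncHat f J K) + osc φ t (dyadicHat f K) := by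
        ext x
        rw [truncHat_succ, osc_add hφ.measurable (isTest_truncHat f J K).integrable
          (isTest_dyadicHat f K).integrable, Pi.add_apply]
      have hqK : q ^ K ≤ 1 := pow_le_one₀ hq0.le hq1.le
      rw [hadd]
      refine (eLpNorm_add_le
        (stronglyMeasurable_osc hφ.measurable ht
          (isTest_truncHat f J K).contDiff.continuous).aestronglyMeasurable
        (stronglyMeasurable_osc hφ.measurable ht
          (isTest_dyadicHat f K).contDiff.continuous).aestronglyMeasurable
        (by norm_num)).trans ((add_le_add ih hdy).trans (le_of_eq ?_))
      have hnonneg : 0 ≤ E / (1 - q) * (1 - q ^ K) :=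
        mul_nonneg (by positivity) (by linarith)
      rw [← add_mul, ← ENNReal.ofReal_add (by positivity) (by positivity)]
      congr 2
      field_simp
      ring
  refine ⟨((D + 1) + E / (1 - q)).toNNReal, fun t ht ht01 f J K => (key t ht ht01 f J K).trans ?_⟩
  gcongr
  refine ENNReal.ofReal_le_ofReal ?_
  have h1 : E / (1 - q) * (1 - q ^ K) ≤ E / (1 - q) :=
    mul_le_of_le_one_right (by positivity) (by linarith [pow_pos hq0 K])
  linarith

theorem tendsto_truncHat {ξ : EuclideanSpace ℝ (Fin n)} (hξ : ξ ≠ 0) :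
    Filter.Tendsto (fun N => truncHat f N N ξ) Filter.atTop (nhds (hat f ξ)) := by
  have hpos : 0 < ‖ξ‖ := norm_pos_iff.2 hξ
  have h2 : Filter.Tendsto (fun N : ℕ => (2 : ℝ) ^ N) Filter.atTop Filter.atTop :=
    tendsto_pow_atTop_atTop_of_one_lt (by norm_num)
  refine tendsto_const_nhds.congr' ?_
  filter_upwards [h2.eventually_ge_atTop ‖ξ‖, h2.eventually_ge_atTop (2 / ‖ξ‖)] with N h3 h4
  rw [div_le_iff₀ hpos] at h4
  rw [truncHat, cutoff_eq_one, cutoff_eq_zero]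
  · simp
  · rw [norm_smul, Real.norm_of_nonneg (by positivity)]
    exact h4
  · rw [norm_smul, norm_inv, Real.norm_of_nonneg (by positivity), inv_mul_le_iff₀ (by positivity)]
    linarith

/-- Dominated convergence with majorant `‖hat f‖`. The truncations never recover the frequency `0`,
a null set because `n ≥ 1`. -/
theorem tendsto_osc_truncHat (hn : 1 ≤ n) (hφ : Measurable φ) (t : EuclideanSpace ℝ (Fin n) → ℝ)
    (x : EuclideanSpace ℝ (Fin n)) :
    Filter.Tendsto (fun N => osc φ t (truncHat f N N) x) Filter.atTop
      (nhds (osc φ t (hat f) x)) := by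
  have : Nonempty (Fin n) := ⟨⟨0, hn⟩⟩
  refine tendsto_integral_of_dominated_convergence (fun ξ => ‖hat f ξ‖)
    (fun N => (integrable_osc hφ (isTest_truncHat f N N).integrable x).aestronglyMeasurable)
    (integrable_hat f).norm (fun N => Filter.Eventually.of_forall fun ξ => ?_) ?_
  · rw [norm_mul, norm_exp_I_mul_ofReal, one_mul, truncHat, norm_mul]
    exact mul_le_of_le_one_left (norm_nonneg _) (norm_ofReal_cutoff_sub_le _ _)
  · have h0 : ∀ᵐ ξ : EuclideanSpace ℝ (Fin n), ξ ≠ 0 :=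
      compl_mem_ae_iff.2 (measure_singleton 0)
    filter_upwards [h0] with ξ hξ
    exact (tendsto_truncHat f hξ).const_mul _

end Summation

end LocalGlobal

end

/-! ### Choice of exponents and conclusion. -/

theorem mainTheorem2 (n : ℕ) (hn : 1 ≤ n) (a : ℝ) (ha : 1 ≤ a)
    (φ : EuclideanSpace ℝ (Fin n) → ℝ) (hφ : LocalGlobal.IsPhase a φ)
    (s₀ : ℝ) (hs₀ : 0 < s₀)
    (hlocal : ∀ s : ℝ, s₀ < s → LocalGlobal.UniformBound φ (Metric.ball 0 1) s) :
    ∀ s : ℝ, a * s₀ < s → LocalGlobal.UniformBound φ Set.univ s := by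
  intro s hs
  have ha0 : 0 < a := by linarith
  have hs0 : 0 < s := (mul_pos ha0 hs₀).trans hs
  -- The room in `a s₀ < s` is spent twice: on `s₁ > s₀`, where the hypothesis applies, and on `b =
  -- a + ε` with `b s₁ < s`, so that the dyadic sum converges.
  obtain ⟨s₁, h1, h2⟩ : ∃ s₁, s₀ < s₁ ∧ s₁ < s / a :=
    exists_between (by rwa [lt_div_iff₀' ha0])
  rw [lt_div_iff₀' ha0] at h2
  have hs₁ : 0 < s₁ := hs₀.trans h1
  obtain ⟨b, hab, hb⟩ : ∃ b, a < b ∧ b < s / s₁ := exists_between (by rwa [lt_div_iff₀ hs₁])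
  rw [lt_div_iff₀ hs₁] at hb
  have hann := hφ.exists_lintegral_osc_annulus_le ha (sub_pos.2 hab) hs₁.le (hlocal s₁ h1)
  rw [add_sub_cancel] at hann
  obtain ⟨C, hC⟩ := LocalGlobal.exists_eLpNorm_osc_truncHat_le hφ ha0.le hs0.le hb hann
  refine ⟨C, fun t ht ht01 f => ?_⟩
  rw [Measure.restrict_univ, LocalGlobal.linOp_eq_osc]
  -- Fatou: the truncated bounds are uniform in `N`, and the truncated integrals converge at every
  -- `x`.
  refine (Lp.eLpNorm_lim_le_liminf_eLpNorm
    (f := fun N => LocalGlobal.osc φ t (LocalGlobal.truncHat f N N)) (fun N =>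
      (LocalGlobal.stronglyMeasurable_osc hφ.measurable ht
        (LocalGlobal.isTest_truncHat f N N).contDiff.continuous).aestronglyMeasurable) _
    (Filter.Eventually.of_forall fun x =>
      LocalGlobal.tendsto_osc_truncHat f hn hφ.measurable t x)).trans ?_
  exact (Filter.liminf_le_liminf (Filter.Eventually.of_forall fun N => hC t ht ht01 f N N)).trans
    (Filter.liminf_const _).le
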